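/- Let $J\subseteq\mathbb{R}$ be an open interval (possibly all of $\mathbb{R}$). Write $f\in BV(J)$ if $f\in L^1_{loc}(J)$ and its distributional derivative $Df$ is a finite signed measure on $J$, with total variation measure $|Df|$. A function $u:[0,\infty)\times J\to\mathbb{R}$ is a strong solution of the total variation flow (TVF) $\partial_t u=\partial_x\big(Du/|Du|\big)$ on $J$ with initial datum $u_0$ (no boundary condition being prescribed) if - $u(t)\in BV(J)$ for a.e. $t>0$ and $\operatorname{ess\,sup}_{t>0}|Du(t)|(J)<\infty$; - $u-u_0\in W^{1,2}_{loc}([0,\infty);L^2(J))$ and $u(0)=u_0$; - there is a measurable $z$ on $(0,\infty)\times J$ with $|z|\le 1$ whose weak derivative $\partial_x z$ belongs to $L^2_{loc}([0,\infty);L^2(J))$ (so that $z(t,\cdot)$ is taken to be continuous for a.e. $t$), such that $\partial_t u=\partial_x z$ on $(0,\infty)\times J$ and $$\int_0^T\!\int_J z(t,x)\,dDu(t)(x)\,dt=\int_0^T |Du(t)|(J)\,dt\qquad\text{for all } T>0 .$$ **Theorem (Local continuity).** Let $u$ be a strong solution of the TVF on $J$ with initial datum $u_0$, and assume that $u_0$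 is continuous on an open interval $I\subseteq J$. Then $u_0$ is bounded on $I$ and, for every $t\ge 0$, $u(t)$ has a representative (up to modification on a Lebesgue null set) which is continuous and bounded on $I$, and for this representative $$\operatorname{osc}_I u(t):=\sup_I u(t)-\inf_I u(t)\ \le\ \sup_I u_0-\inf_I u_0=\operatorname{osc}_I u_0 .$$ -/

import Mathlib

open MeasureTheory Set
open scoped ContDiff NNReal

namespace TVF

/-- `φ` is a test function on the open set `J`: smooth, with compact support contained in `J`. -/
structure IsTestFunction (J : Set ℝ) (φ : ℝ → ℝ) : Prop where
  smooth : ContDiff ℝ ∞ φ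
  compactSupport : HasCompactSupport φ
  support_subset : tsupport φ ⊆ J

/-- The function `g ∈ L¹_loc(J)` is the weak derivative of `f ∈ L¹_loc(J)` on the open set `J`. -/
structure HasWeakDeriv (J : Set ℝ) (f g : ℝ → ℝ) : Prop where
  locallyIntegrable : LocallyIntegrableOn f J
  locallyIntegrable_deriv : LocallyIntegrableOn g J
  integral_eq : ∀ φ : ℝ → ℝ, IsTestFunction J φ →
    ∫ x in J, f x * deriv φ x = - ∫ x in J, g x * φ x

/-- `f ∈ BV(J)` with distributional derivative `Df = μ` on the open set `J`: `f` is locally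
integrable on `J` and its distributional derivative is the (finite) signed measure `μ`.
Only the restriction of `μ` to `J` matters. -/
structure HasBVDeriv (J : Set ℝ) (f : ℝ → ℝ) (μ : SignedMeasure ℝ) : Prop where
  locallyIntegrable : LocallyIntegrableOn f J
  integral_eq : ∀ φ : ℝ → ℝ, IsTestFunction J φ →
    ∫ x in J, f x * deriv φ x = - ∫ᵛ x in J, φ x ∂•μ

/-- `u` is a strong solution on `[0, ∞) × J` of the total variation flow `∂ₜu = ∂ₓ(Du / |Du|)`
with initial datum `u₀`, where `z` is the vector field "`Du / |Du|`", `g = ∂ₜu = ∂ₓz`, and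
`D t = Du(t)`. No boundary condition is imposed. -/
structure IsStrongSolutionWith (J : Set ℝ) (u₀ : ℝ → ℝ) (u : ℝ → ℝ → ℝ)
    (z g : ℝ → ℝ → ℝ) (D : ℝ → SignedMeasure ℝ) : Prop where
  /-- `u(t) ∈ BV(J)` with derivative `D t` for almost every `t > 0`. -/
  hasBVDeriv : ∀ᵐ t ∂(volume.restrict (Ioi (0 : ℝ))), HasBVDeriv J (u t) (D t)
  /-- The total variation of `u(t)` on `J` is essentially bounded in time. -/
  variation_le : ∃ C : ℝ≥0, ∀ᵐ t ∂(volume.restrict (Ioi (0 : ℝ))), (D t).variation J ≤ C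
  /-- `g ∈ L²_loc([0, ∞); L²(J))`. -/
  memLp : ∀ T : ℝ, 0 < T → MemLp (Function.uncurry g) 2
    ((volume.restrict (Ioo 0 T)).prod (volume.restrict J))
  /-- `u - u₀ ∈ W^{1,2}_loc([0, ∞); L²(J))`, with time derivative `g` and `u(0) = u₀`. -/
  eq_add_integral : ∀ t : ℝ, 0 ≤ t →
    ∀ᵐ x ∂(volume.restrict J), u t x = u₀ x + ∫ s in (0 : ℝ)..t, g s x
  /-- `z` is jointly measurable. -/
  aestronglyMeasurable : AEStronglyMeasurable (Function.uncurry z)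
    ((volume.restrict (Ioi (0 : ℝ))).prod (volume.restrict J))
  /-- `z(t)` is the continuous representative of its class. -/
  continuousOn : ∀ᵐ t ∂(volume.restrict (Ioi (0 : ℝ))), ContinuousOn (z t) J
  /-- `‖z‖_∞ ≤ 1`. -/
  abs_le_one : ∀ᵐ t ∂(volume.restrict (Ioi (0 : ℝ))), ∀ x ∈ J, |z t x| ≤ 1
  /-- `∂ₓz = g`, hence `∂ₓz = ∂ₜu`. -/
  hasWeakDeriv : ∀ᵐ t ∂(volume.restrict (Ioi (0 : ℝ))), HasWeakDeriv J (z t) (g t)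
  /-- Both sides of the next identity are integrable in time. -/
  intervalIntegrable_pairing : ∀ T : ℝ, 0 < T →
    IntervalIntegrable (fun t => ∫ᵛ x in J, z t x ∂•(D t)) volume 0 T
  intervalIntegrable_variation : ∀ T : ℝ, 0 < T →
    IntervalIntegrable (fun t => (D t).variation.real J) volume 0 T
  /-- `∫₀ᵀ ∫_J z dDu dt = ∫₀ᵀ |Du(t)|(J) dt`. -/
  integral_pairing_eq : ∀ T : ℝ, 0 < T →
    ∫ t in (0 : ℝ)..T, (∫ᵛ x in J, z t x ∂•(D t)) =
      ∫ t in (0 : ℝ)..T, (D t).variation.real J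

/-- `u` is a strong solution of the total variation flow on `[0, ∞) × J` with initial
datum `u₀`. -/
def IsStrongSolution (J : Set ℝ) (u₀ : ℝ → ℝ) (u : ℝ → ℝ → ℝ) : Prop :=
  ∃ (z g : ℝ → ℝ → ℝ) (D : ℝ → SignedMeasure ℝ), IsStrongSolutionWith J u₀ u z g D

/-- The oscillation `sup_I f - inf_I f` (for `f` bounded on `I`). -/
noncomputable def osc (I : Set ℝ) (f : ℝ → ℝ) : ℝ := sSup (f '' I) - sInf (f '' I)

end TVF

/-!
The idea is that the oscillation of a strong solution over *any* interval is nonincreasing in time,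
whatever happens at the endpoints. Fix `[a, b] ⊆ J` and `k ≥ 0`, let `φ` be the function `ramp`
(nondecreasing, zero exactly on `(-∞, 0]`, with values in `[0, 1]`) and `ψ` its primitive. Then the
time derivative of `∬ ψ(u(t,x) - u(t,y) - k) dx dy` over `(a, b)²` is
`∬ φ(u(t,x) - u(t,y) - k) (∂ₓz(t,x) - ∂ₓz(t,y)) dx dy`, and this is nonpositive. Indeed, for fixed
`y`, the function `w(x) = φ(u(t,x) - u(t,y) - k)` vanishes at `y`, and `z = ±1` where `u` goes up or
down, so that formally, with `|z| ≤ 1`,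
`∫ w ∂ₓz = w(b) z(b) - w(a) z(a) - ∫ z dw ≤ w(b) + w(a) - |Dw|(a, b) ≤ 0`.
If `u₀(x) - u₀(y) ≤ k` on `[a, b]`, the double integral vanishes at time `0`, hence at all times,
that is, `u(t,x) - u(t,y) ≤ k` almost everywhere.

The formal integration by parts is done without a chain rule in `BV`: on `[y, b]` the function
`x ↦ ∫_y^x w ∂ₓz - w(x) (z(x) - 1)` has increments bounded by a product of increments of a
continuous and of a monotone function, so it is nonincreasing (`le_of_sub_le_mul_sub`,
`integral_mul_le_boundary`); on `[a, y]` one uses `z + 1` instead. This needs a pointwise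
representative of `u(t)`, which is the distribution function of `Du(t)` up to a constant
(`HasBVDeriv.exists_ae_eq`), and the fact that the pairing identity forces `z = 1` almost everywhere
for the positive part of `Du(t)` and `z = -1` for its negative part
(`setIntegral_signedMeasure_le_variation`). The time integration is
`ae_sub_le_of_ae_integral_nonpos`.

Applied to small intervals `[a, b] ⊆ I`, the oscillation bound transfers the modulus of continuity
of `u₀` to `u(t)` on a set of full measure, from which `u(t)` extends continuously to `I`
(`exists_continuousOn_ae_eq`); applied to large ones it bounds the oscillation over `I`. Finally,
`u₀` is bounded on `I` because it is the pointwise limit of `u(tₙ)` along times `tₙ → 0` at which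
`|Du(tₙ)|(J)` is bounded (`IsStrongSolutionWith.exists_sub_le`).
-/

namespace TVF

/-! ### A Stieltjes inequality on an interval -/

/-- If the increments of `M` are at most the product of those of a continuous function and of a
monotone function, then `M` does not increase: on a fine partition the continuous factor is at most
`ε`, and the monotone one telescopes. -/
theorem le_of_sub_le_mul_sub {M Γ V : ℝ → ℝ} {a b : ℝ} (hab : a ≤ b)
    (hΓ : ContinuousOn Γ (Icc a b)) (hV : MonotoneOn V (Icc a b))
    (h : ∀ x ∈ Icc a b, ∀ y ∈ Icc a b, x ≤ y → M y - M x ≤ (Γ y - Γ x) * (V y - V x)) :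
    M b ≤ M a := by
  have ha : a ∈ Icc a b := left_mem_Icc.2 hab
  have hb : b ∈ Icc a b := right_mem_Icc.2 hab
  have huc := isCompact_Icc.uniformContinuousOn_of_continuous hΓ
  have key : ∀ ε > 0, M b - M a ≤ ε * (V b - V a) := by
    intro ε hε
    obtain ⟨δ, hδ, hδ'⟩ := Metric.uniformContinuousOn_iff.1 huc ε hε
    have step : ∀ n : ℕ, ∀ x ∈ Icc a b, ∀ y ∈ Icc a b, x ≤ y → y - x ≤ n * (δ / 2) →
        M y - M x ≤ ε * (V y - V x) := by
      intro n
      induction n with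
      | zero =>
        intro x hx y hy hxy hn
        have : x = y := by simp at hn; linarith
        subst this; simp
      | succ n ih =>
        intro x hx y hy hxy hn
        -- the last step of the chain has length at most `δ / 2`
        set m := max x (y - δ / 2) with hm
        have hxm : x ≤ m := le_max_left _ _
        have hmy : m ≤ y := max_le hxy (by linarith)
        have hmI : m ∈ Icc a b := ⟨hx.1.trans hxm, hmy.trans hy.2⟩
        have h1 := ih x hx m hmI hxm (by
          rcases max_cases x (y - δ / 2) with ⟨h, _⟩ | ⟨h, _⟩
          · rw [hm, h]; simp; positivity
          · rw [hm, h]; push_cast at hn; linarith)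
        have h2 := h m hmI y hy hmy
        have h3 : Γ y - Γ m ≤ ε := by
          have := hδ' y hy m hmI (by
            rw [Real.dist_eq, abs_of_nonneg (by linarith)]
            have := le_max_right x (y - δ / 2)
            linarith)
          rw [Real.dist_eq] at this
          exact (le_abs_self _).trans this.le
        have h4 : 0 ≤ V y - V m := sub_nonneg.2 (hV hmI hy hmy)
        nlinarith [mul_le_mul_of_nonneg_right h3 h4]
    obtain ⟨n, hn⟩ := exists_nat_ge ((b - a) / (δ / 2))
    exact step n a ha b hb hab ((div_le_iff₀ (by positivity)).1 hn)
  have hVab : 0 ≤ V b - V a := sub_nonneg.2 (hV ha hb hab)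
  refine le_of_forall_pos_le_add fun η hη => ?_
  have := key (η / (V b - V a + 1)) (by positivity)
  have h2 : η / (V b - V a + 1) * (V b - V a) ≤ η := by
    rw [div_mul_eq_mul_div, div_le_iff₀ (by positivity)]
    nlinarith
  linarith

theorem intervalIntegrable_mul_of_abs_sub_le {a b : ℝ} (hab : a ≤ b) {w g V : ℝ → ℝ}
    (hg : IntervalIntegrable g volume a b) (hwm : Measurable w) (hV : MonotoneOn V (Icc a b))
    (hw : ∀ x ∈ Icc a b, ∀ y ∈ Icc a b, x ≤ y → |w y - w x| ≤ V y - V x) :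
    IntervalIntegrable (fun x => w x * g x) volume a b := by
  rw [intervalIntegrable_iff] at hg ⊢
  refine hg.bdd_mul (c := |w a| + (V b - V a)) hwm.aestronglyMeasurable ?_
  filter_upwards [ae_restrict_mem measurableSet_uIoc] with x hx
  rw [uIoc_of_le hab] at hx
  have hx' : x ∈ Icc a b := Ioc_subset_Icc_self hx
  have h1 := hw a (left_mem_Icc.2 hab) x hx' hx'.1
  have h2 := hV hx' (right_mem_Icc.2 hab) hx'.2
  have h3 : |w x| ≤ |w a| + |w x - w a| := by
    simpa using abs_add_le (w a) (w x - w a)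
  rw [Real.norm_eq_abs]; linarith

/-- The inequality `∫ w dζ ≤ [w ζ]` for a primitive `ζ` of `g`, where `w` may jump: it says that
`∫ ζ dw ≥ 0`, and it holds because every interval over which `w` increases meets `{ζ ≥ 0}`, and
every interval over which it decreases meets `{ζ ≤ 0}`. The function `V` dominates the variation of
`w`. -/
theorem integral_mul_le_boundary {a b : ℝ} (hab : a ≤ b) {w ζ g V : ℝ → ℝ}
    (hg : IntervalIntegrable g volume a b) (hwm : Measurable w)
    (hV : MonotoneOn V (Icc a b))
    (hw : ∀ x ∈ Icc a b, ∀ y ∈ Icc a b, x ≤ y → |w y - w x| ≤ V y - V x)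
    (hζ : ∀ x ∈ Icc a b, ∀ y ∈ Icc a b, x ≤ y → ζ y - ζ x = ∫ t in x..y, g t)
    (hup : ∀ x ∈ Icc a b, ∀ y ∈ Icc a b, x ≤ y → w x < w y → ∃ p ∈ Icc x y, 0 ≤ ζ p)
    (hdown : ∀ x ∈ Icc a b, ∀ y ∈ Icc a b, x ≤ y → w y < w x → ∃ p ∈ Icc x y, ζ p ≤ 0) :
    ∫ x in a..b, w x * g x ≤ w b * ζ b - w a * ζ a := by
  have sub : ∀ {x y : ℝ}, x ∈ Icc a b → y ∈ Icc a b → uIcc x y ⊆ uIcc a b := by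
    intro x y hx hy
    rw [uIcc_of_le hab]
    exact (ordConnected_Icc).uIcc_subset hx hy
  have hwg := intervalIntegrable_mul_of_abs_sub_le hab hg hwm hV hw
  have hgs : ∀ {x y : ℝ}, x ∈ Icc a b → y ∈ Icc a b → IntervalIntegrable g volume x y :=
    fun hx hy => hg.mono_set (sub hx hy)
  have hwgs : ∀ {x y : ℝ}, x ∈ Icc a b → y ∈ Icc a b →
      IntervalIntegrable (fun x => w x * g x) volume x y :=
    fun hx hy => hwg.mono_set (sub hx hy)
  have ha : a ∈ Icc a b := left_mem_Icc.2 hab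
  -- the increment of `M` on `[x, y]` is `∫ (w - w x) g - (w y - w x) ζ y`, and `ζ y` has the sign
  -- of `w y - w x` up to an error of at most `∫ |g|`
  have main := le_of_sub_le_mul_sub (M := fun x => (∫ t in a..x, w t * g t) - w x * ζ x)
    (Γ := fun x => 2 * ∫ t in a..x, |g t|) (V := V) hab ?_ hV ?_
  · simp only [intervalIntegral.integral_same] at main
    linarith
  · have := intervalIntegral.continuousOn_primitive_interval' hg.abs
      (left_mem_uIcc (a := a) (b := b))
    rw [uIcc_of_le hab] at this
    exact this.const_smul (2 : ℝ)
  · intro x hx y hy hxy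
    have e1 : (∫ t in a..y, w t * g t) - ∫ t in a..x, w t * g t = ∫ t in x..y, w t * g t :=
      intervalIntegral.integral_interval_sub_left (hwgs ha hy) (hwgs ha hx)
    have e2 : (∫ t in a..y, |g t|) - ∫ t in a..x, |g t| = ∫ t in x..y, |g t| :=
      intervalIntegral.integral_interval_sub_left (hgs ha hy).abs (hgs ha hx).abs
    have e3 : ∫ t in x..y, (w t - w x) * g t = (∫ t in x..y, w t * g t) - w x * (ζ y - ζ x) := by
      rw [hζ x hx y hy hxy, ← intervalIntegral.integral_const_mul,
        ← intervalIntegral.integral_sub (hwgs hx hy) ((hgs hx hy).const_mul _)]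
      simp only [sub_mul]
    have hVxy : 0 ≤ V y - V x := sub_nonneg.2 (hV hx hy hxy)
    have hGn : 0 ≤ ∫ t in x..y, |g t| :=
      intervalIntegral.integral_nonneg hxy fun _ _ => abs_nonneg _
    have b1 : ∫ t in x..y, (w t - w x) * g t ≤ (V y - V x) * ∫ t in x..y, |g t| := by
      rw [← intervalIntegral.integral_const_mul]
      refine intervalIntegral.integral_mono_on hxy ?_ ((hgs hx hy).abs.const_mul _) ?_
      · simp only [sub_mul]
        exact (hwgs hx hy).sub ((hgs hx hy).const_mul _)
      · intro t ht
        have htI : t ∈ Icc a b := ⟨hx.1.trans ht.1, ht.2.trans hy.2⟩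
        have h1 := hw x hx t htI ht.1
        have h2 := hV htI hy ht.2
        calc (w t - w x) * g t ≤ |w t - w x| * |g t| := by
              rw [← abs_mul]; exact le_abs_self _
          _ ≤ _ := mul_le_mul_of_nonneg_right (by linarith) (abs_nonneg _)
    have hζp : ∀ p ∈ Icc x y, |ζ y - ζ p| ≤ ∫ t in x..y, |g t| := by
      intro p hp
      have hpI : p ∈ Icc a b := ⟨hx.1.trans hp.1, hp.2.trans hy.2⟩
      rw [hζ p hpI y hy hp.2]
      refine (intervalIntegral.abs_integral_le_integral_abs hp.2).trans ?_
      exact intervalIntegral.integral_mono_interval hp.1 hp.2 le_rfl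
        (Filter.Eventually.of_forall fun _ => abs_nonneg _) (hgs hx hy).abs
    have b2 : -((w y - w x) * ζ y) ≤ (V y - V x) * ∫ t in x..y, |g t| := by
      have hwxy := hw x hx y hy hxy
      rcases lt_trichotomy (w x) (w y) with hlt | heq | hgt
      · obtain ⟨p, hp, hp0⟩ := hup x hx y hy hxy hlt
        have h1 := (abs_le.1 (hζp p hp)).1
        rw [abs_of_pos (sub_pos.2 hlt)] at hwxy
        nlinarith [mul_le_mul hwxy (le_refl (∫ t in x..y, |g t|)) hGn hVxy, sub_pos.2 hlt]
      · rw [heq]; simp; positivity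
      · obtain ⟨p, hp, hp0⟩ := hdown x hx y hy hxy hgt
        have h1 := (abs_le.1 (hζp p hp)).2
        rw [abs_of_neg (sub_neg.2 hgt)] at hwxy
        nlinarith [mul_le_mul hwxy (le_refl (∫ t in x..y, |g t|)) hGn hVxy, sub_pos.2 hgt]
    have e4 : (2 * ∫ t in a..y, |g t|) - 2 * ∫ t in a..x, |g t| = 2 * ∫ t in x..y, |g t| := by
      rw [← e2]; ring
    rw [e4]
    nlinarith

/-- Left of a zero `c` of `w` the primitive `z + 1 ≥ 0` of `g` is used, right of it the primitive
`z - 1 ≤ 0`: then the boundary terms have the right sign. -/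
theorem integral_mul_nonpos_of_zero {a b : ℝ} {w z g V : ℝ → ℝ}
    (hg : IntervalIntegrable g volume a b) (hwm : Measurable w) (hw0 : ∀ x, 0 ≤ w x)
    (hV : Monotone V)
    (hw : ∀ x y, x ≤ y → |w y - w x| ≤ V y - V x)
    (hz1 : ∀ x ∈ Icc a b, |z x| ≤ 1)
    (hz : ∀ x ∈ Icc a b, ∀ y ∈ Icc a b, x ≤ y → z y - z x = ∫ t in x..y, g t)
    (hup : ∀ x ∈ Icc a b, ∀ y ∈ Icc a b, x ≤ y → w x < w y → ∃ p ∈ Icc x y, z p = 1)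
    (hdown : ∀ x ∈ Icc a b, ∀ y ∈ Icc a b, x ≤ y → w y < w x → ∃ p ∈ Icc x y, z p = -1)
    {c : ℝ} (hc : c ∈ Icc a b) (hwc : w c = 0) :
    ∫ x in a..b, w x * g x ≤ 0 := by
  have hab : a ≤ b := hc.1.trans hc.2
  have hl : ∀ {x}, x ∈ Icc a c → x ∈ Icc a b := fun hx => ⟨hx.1, hx.2.trans hc.2⟩
  have hr : ∀ {x}, x ∈ Icc c b → x ∈ Icc a b := fun hx => ⟨hc.1.trans hx.1, hx.2⟩
  have hgl : IntervalIntegrable g volume a c := hg.mono_set (by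
    rw [uIcc_of_le hab, uIcc_of_le hc.1]; exact fun _ => hl)
  have hgr : IntervalIntegrable g volume c b := hg.mono_set (by
    rw [uIcc_of_le hab, uIcc_of_le hc.2]; exact fun _ => hr)
  have left := integral_mul_le_boundary hc.1 (ζ := fun x => z x + 1) hgl hwm
    (hV.monotoneOn _) (fun x _ y _ => hw x y)
    (fun x hx y hy hxy => by rw [← hz x (hl hx) y (hl hy) hxy]; ring)
    (fun x hx y hy hxy hlt => by
      obtain ⟨p, hp, h⟩ := hup x (hl hx) y (hl hy) hxy hlt
      exact ⟨p, hp, by rw [h]; norm_num⟩)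
    (fun x hx y hy hxy hlt => by
      obtain ⟨p, hp, h⟩ := hdown x (hl hx) y (hl hy) hxy hlt
      exact ⟨p, hp, by rw [h]; norm_num⟩)
  have right := integral_mul_le_boundary hc.2 (ζ := fun x => z x - 1) hgr hwm
    (hV.monotoneOn _) (fun x _ y _ => hw x y)
    (fun x hx y hy hxy => by rw [← hz x (hr hx) y (hr hy) hxy]; ring)
    (fun x hx y hy hxy hlt => by
      obtain ⟨p, hp, h⟩ := hup x (hr hx) y (hr hy) hxy hlt
      exact ⟨p, hp, by rw [h]; norm_num⟩)
    (fun x hx y hy hxy hlt => by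
      obtain ⟨p, hp, h⟩ := hdown x (hr hx) y (hr hy) hxy hlt
      exact ⟨p, hp, by rw [h]; norm_num⟩)
  rw [← intervalIntegral.integral_add_adjacent_intervals
    (intervalIntegrable_mul_of_abs_sub_le hc.1 hgl hwm (hV.monotoneOn _) fun x _ y _ => hw x y)
    (intervalIntegrable_mul_of_abs_sub_le hc.2 hgr hwm (hV.monotoneOn _) fun x _ y _ => hw x y)]
  have za := (abs_le.1 (hz1 a (left_mem_Icc.2 hab))).1
  have zb := (abs_le.1 (hz1 b (right_mem_Icc.2 hab))).2
  rw [hwc] at left right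
  nlinarith [mul_nonneg (hw0 a) (by linarith : 0 ≤ z a + 1),
    mul_nonneg (hw0 b) (by linarith : 0 ≤ 1 - z b)]

/-! ### Distributional derivatives on an interval -/

theorem setIntegral_signedMeasure_eq {D : SignedMeasure ℝ} {J : Set ℝ} (hJ : MeasurableSet J)
    {φ : ℝ → ℝ} (hφ : IntegrableOn φ J D.totalVariation) :
    ∫ᵛ x in J, φ x ∂•D = (∫ x in J, φ x ∂D.toJordanDecomposition.posPart) -
      ∫ x in J, φ x ∂D.toJordanDecomposition.negPart := by
  have hp : IntegrableOn φ J D.toJordanDecomposition.posPart :=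
    hφ.mono_measure (by rw [SignedMeasure.totalVariation]; exact Measure.le_add_right le_rfl)
  have hn : IntegrableOn φ J D.toJordanDecomposition.negPart :=
    hφ.mono_measure (by rw [SignedMeasure.totalVariation]; exact Measure.le_add_left le_rfl)
  have e : D.restrict J = (D.toJordanDecomposition.posPart.restrict J).toSignedMeasure -
      (D.toJordanDecomposition.negPart.restrict J).toSignedMeasure := by
    ext s hs
    rw [VectorMeasure.restrict_apply _ hJ hs,
      SignedMeasure.apply_eq_posPart_real_sub_negPart_real D (hs.inter hJ),
      sub_apply, Measure.toSignedMeasure_apply_measurable hs,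
      Measure.toSignedMeasure_apply_measurable hs, measureReal_restrict_apply hs,
      measureReal_restrict_apply hs]
  have hflip : ContinuousLinearMap.lsmul ℝ ℝ (E := ℝ) =
      (ContinuousLinearMap.lsmul ℝ ℝ (E := ℝ)).flip := by
    ext; simp
  rw [e, VectorMeasure.integral_sub_vectorMeasure, hflip,
    VectorMeasure.integral_toSignedMeasure, VectorMeasure.integral_toSignedMeasure]
  · rw [VectorMeasure.Integrable, Measure.variation_toSignedMeasure]; exact hp
  · rw [VectorMeasure.Integrable, Measure.variation_toSignedMeasure]; exact hn

theorem IsTestFunction.eq_zero_of_notMem {J : Set ℝ} {φ : ℝ → ℝ} (hφ : IsTestFunction J φ)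
    {x : ℝ} (hx : x ∉ J) : φ x = 0 :=
  image_eq_zero_of_notMem_tsupport fun h => hx (hφ.support_subset h)

theorem IsTestFunction.deriv {J : Set ℝ} {φ : ℝ → ℝ} (hφ : IsTestFunction J φ) :
    IsTestFunction J (deriv φ) where
  smooth := (contDiff_infty_iff_deriv.1 hφ.smooth).2
  compactSupport := hφ.compactSupport.deriv
  support_subset := (tsupport_deriv_subset (𝕜 := ℝ)).trans hφ.support_subset

theorem IsTestFunction.integrable_mul {J : Set ℝ} {φ k : ℝ → ℝ} (hφ : IsTestFunction J φ)
    (hk : LocallyIntegrableOn k J) : Integrable fun x => k x * φ x := by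
  have h1 : IntegrableOn k (tsupport φ) :=
    hk.integrableOn_compact_subset hφ.support_subset hφ.compactSupport
  have h2 : IntegrableOn (fun x => k x * φ x) (tsupport φ) :=
    h1.mul_continuousOn hφ.smooth.continuous.continuousOn hφ.compactSupport
  refine (integrableOn_iff_integrable_of_support_subset fun x hx => ?_).1 h2
  exact subset_tsupport φ fun h0 => hx (by simp [h0])

theorem IsTestFunction.exists_tsupport_subset_Ioo {J : Set ℝ} (hJ : IsOpen J)
    (hne : J.Nonempty) {φ : ℝ → ℝ} (hφ : IsTestFunction J φ) :
    ∃ p ∈ J, ∃ q ∈ J, p < q ∧ tsupport φ ⊆ Ioo p q := by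
  rcases (tsupport φ).eq_empty_or_nonempty with he | hne'
  · obtain ⟨c, hc⟩ := hne
    obtain ⟨ε, hε, hball⟩ := Metric.isOpen_iff.1 hJ c hc
    refine ⟨c, hc, c + ε / 2, hball ?_, by linarith, by simp [he]⟩
    rw [Metric.mem_ball, Real.dist_eq, add_sub_cancel_left, abs_of_pos (by linarith)]
    linarith
  · have hK : IsCompact (tsupport φ) := hφ.compactSupport
    obtain ⟨l, hl, hl'⟩ := hK.exists_isLeast hne'
    obtain ⟨r, hr, hr'⟩ := hK.exists_isGreatest hne'
    obtain ⟨ε, hε, hball⟩ := Metric.isOpen_iff.1 hJ l (hφ.support_subset hl)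
    obtain ⟨δ, hδ, hball'⟩ := Metric.isOpen_iff.1 hJ r (hφ.support_subset hr)
    have hlr := hl' hr
    refine ⟨l - ε / 2, hball ?_, r + δ / 2, hball' ?_, by linarith, fun x hx => ?_⟩
    · rw [Metric.mem_ball, Real.dist_eq, abs_lt]; constructor <;> linarith
    · rw [Metric.mem_ball, Real.dist_eq, abs_lt]; constructor <;> linarith
    · have := hl' hx
      have := hr' hx
      constructor <;> linarith

/-- A test function on an interval with zero mean is the derivative of a test function. -/
theorem exists_isTestFunction_deriv_eq {J : Set ℝ} (hJ : IsOpen J) (hJc : J.OrdConnected)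
    (hne : J.Nonempty) {ψ : ℝ → ℝ} (hψ : IsTestFunction J ψ) (h0 : ∫ x, ψ x = 0) :
    ∃ φ : ℝ → ℝ, IsTestFunction J φ ∧ deriv φ = ψ := by
  obtain ⟨p, hp, q, hq, hpq, hsub⟩ := hψ.exists_tsupport_subset_Ioo hJ hne
  have hcont : Continuous ψ := hψ.smooth.continuous
  have hz : ∀ x, x ∉ Ioo p q → ψ x = 0 := fun x hx =>
    image_eq_zero_of_notMem_tsupport fun h => hx (hsub h)
  have hd : ∀ x, HasDerivAt (fun x => ∫ t in p..x, ψ t) (ψ x) x := fun x =>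
    hcont.integral_hasStrictDerivAt p x |>.hasDerivAt
  have hderiv : deriv (fun x => ∫ t in p..x, ψ t) = ψ := funext fun x => (hd x).deriv
  have hzero : ∀ x, x ∉ Icc p q → ∫ t in p..x, ψ t = 0 := by
    intro x hx
    rcases lt_or_ge x p with hxp | hxp
    · refine intervalIntegral.integral_zero_ae (Filter.Eventually.of_forall fun t ht => hz t ?_)
      rw [uIoc_of_ge hxp.le] at ht
      exact fun h => absurd h.1 (not_lt.2 ht.2)
    · have hxq : q < x := by
        by_contra hcon
        exact hx ⟨hxp, not_lt.1 hcon⟩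
      rw [intervalIntegral.integral_of_le hxp, setIntegral_eq_integral_of_forall_compl_eq_zero, h0]
      exact fun t ht => hz t fun h => ht ⟨h.1, h.2.le.trans hxq.le⟩
  refine ⟨fun x => ∫ t in p..x, ψ t, ⟨?_, ?_, ?_⟩, hderiv⟩
  · rw [contDiff_infty_iff_deriv, hderiv]
    exact ⟨fun x => (hd x).differentiableAt, hψ.smooth⟩
  · exact HasCompactSupport.intro isCompact_Icc hzero
  · refine (closure_minimal (fun x hx => ?_) isClosed_Icc).trans (hJc.out hp hq)
    by_contra hcon
    exact hx (hzero x hcon)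

/-- The du Bois-Reymond lemma: a function with vanishing weak derivative on an interval is
constant. -/
theorem ae_eq_const_of_integral_mul_deriv_eq_zero {J : Set ℝ} (hJ : IsOpen J)
    (hJc : J.OrdConnected) {k : ℝ → ℝ} (hk : LocallyIntegrableOn k J)
    (h : ∀ φ : ℝ → ℝ, IsTestFunction J φ → ∫ x in J, k x * deriv φ x = 0) :
    ∃ c : ℝ, ∀ᵐ x ∂(volume.restrict J), k x = c := by
  rcases J.eq_empty_or_nonempty with rfl | hne
  · exact ⟨0, by simp⟩
  obtain ⟨c, hc⟩ := hne
  obtain ⟨ε, hε, hball⟩ := Metric.isOpen_iff.1 hJ c hc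
  -- a test function `η` of integral `1`; then `φ - (∫ φ) η` is a derivative for every `φ`
  let b : ContDiffBump c := ⟨ε / 4, ε / 2, by positivity, by linarith⟩
  have hη : IsTestFunction J (b.normed volume) := by
    refine ⟨b.contDiff_normed, b.hasCompactSupport_normed, ?_⟩
    rw [b.tsupport_normed_eq]
    exact (Metric.closedBall_subset_ball (by change ε / 2 < ε; linarith)).trans hball
  have hη1 : ∫ x, b.normed volume x = 1 := b.integral_normed
  set η := b.normed volume
  have hint : ∀ {φ : ℝ → ℝ}, IsTestFunction J φ → Integrable fun x => φ x * k x := fun hφ => by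
    simpa only [mul_comm] using hφ.integrable_mul hk
  refine ⟨∫ x, η x * k x, ?_⟩
  have key := hJ.ae_eq_zero_of_integral_contDiff_smul_eq_zero (μ := volume)
    (f := fun x => k x - ∫ x, η x * k x)
    (hk.sub ((locallyIntegrable_const _).locallyIntegrableOn J)) ?_
  · rw [ae_restrict_iff' hJ.measurableSet]
    filter_upwards [key] with x hx hxJ
    exact sub_eq_zero.1 (hx hxJ)
  intro φ hφ1 hφ2 hφ3
  have hφ : IsTestFunction J φ := ⟨hφ1, hφ2, hφ3⟩
  have hφi : Integrable φ := hφ1.continuous.integrable_of_hasCompactSupport hφ2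
  have hηi : Integrable η := hη.smooth.continuous.integrable_of_hasCompactSupport hη.compactSupport
  have hψ : IsTestFunction J (fun x => φ x - (∫ y, φ y) * η x) := by
    refine ⟨hφ1.sub (contDiff_const.mul hη.smooth), hφ2.sub hη.compactSupport.mul_left, ?_⟩
    refine (tsupport_sub _ _).trans (union_subset hφ3 ?_)
    exact (tsupport_mul_subset_right).trans hη.support_subset
  obtain ⟨Φ, hΦ, hΦ'⟩ := exists_isTestFunction_deriv_eq hJ hJc ⟨c, hc⟩ hψ (by
    rw [integral_sub hφi (hηi.const_mul _), integral_const_mul, hη1]; simp)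
  have h0 := h Φ hΦ
  rw [hΦ', setIntegral_eq_integral_of_forall_compl_eq_zero (fun x hx =>
    mul_eq_zero_of_right _ (hψ.eq_zero_of_notMem hx))] at h0
  have e1 : ∫ x, k x * (φ x - (∫ y, φ y) * η x) =
      (∫ x, φ x * k x) - (∫ y, φ y) * ∫ x, η x * k x := by
    rw [← integral_const_mul, ← integral_sub (hint hφ) ((hint hη).const_mul _)]
    exact integral_congr_ae (Filter.Eventually.of_forall fun x => by ring)
  have e2 : ∫ x, φ x • (k x - ∫ x, η x * k x) =
      (∫ x, φ x * k x) - (∫ y, φ y) * ∫ x, η x * k x := by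
    rw [← integral_mul_const, ← integral_sub (hint hφ) (hφi.mul_const _)]
    exact integral_congr_ae (Filter.Eventually.of_forall fun x => by simp only [smul_eq_mul]; ring)
  rw [e2, ← e1, h0]

/-- A finite measure is the distributional derivative of its distribution function. -/
theorem integral_measureReal_Iic_mul_deriv (m : Measure ℝ) [IsFiniteMeasure m] {φ : ℝ → ℝ}
    (hφ : ContDiff ℝ ∞ φ) (hs : HasCompactSupport φ) :
    ∫ x, m.real (Iic x) * deriv φ x = - ∫ x, φ x ∂m := by
  have hd : Continuous (deriv φ) := hφ.continuous_deriv (by simp)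
  have hdi : Integrable (deriv φ) := hd.integrable_of_hasCompactSupport hs.deriv
  have hmeas : MeasurableSet {p : ℝ × ℝ | p.2 ≤ p.1} :=
    measurableSet_le measurable_snd measurable_fst
  have e1 : ∀ x, m.real (Iic x) * deriv φ x =
      ∫ s, {p : ℝ × ℝ | p.2 ≤ p.1}.indicator (fun p => deriv φ p.1) (x, s) ∂m := by
    intro x
    have : (fun s => {p : ℝ × ℝ | p.2 ≤ p.1}.indicator (fun p => deriv φ p.1) (x, s)) =
        (Iic x).indicator fun _ => deriv φ x := by
      ext s; simp [indicator]
    rw [this, integral_indicator measurableSet_Iic, setIntegral_const, smul_eq_mul]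
  simp_rw [e1]
  have hprod : Integrable (fun p : ℝ × ℝ => deriv φ p.1) (volume.prod m) := hdi.comp_fst m
  rw [integral_integral_swap (f := fun x s =>
    {p : ℝ × ℝ | p.2 ≤ p.1}.indicator (fun p => deriv φ p.1) (x, s)) (hprod.indicator hmeas),
    ← integral_neg]
  refine integral_congr_ae (Filter.Eventually.of_forall fun s => ?_)
  have : (fun x => {p : ℝ × ℝ | p.2 ≤ p.1}.indicator (fun p => deriv φ p.1) (x, s)) =
      (Ici s).indicator (deriv φ) := by
    ext x; simp [indicator]
  simp only
  rw [this, integral_indicator measurableSet_Ici, integral_Ici_eq_integral_Ioi]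
  exact hs.integral_Ioi_deriv_eq (hφ.of_le (by simp)) s

/-- A function of bounded variation is, up to a constant, the distribution function of its
derivative. -/
theorem HasBVDeriv.exists_ae_eq {J : Set ℝ} (hJ : IsOpen J) (hJc : J.OrdConnected) {f : ℝ → ℝ}
    {D : SignedMeasure ℝ} (h : HasBVDeriv J f D) :
    ∃ c : ℝ, ∀ᵐ x ∂(volume.restrict J), f x = c +
      (D.toJordanDecomposition.posPart.real (Iic x) -
        D.toJordanDecomposition.negPart.real (Iic x)) := by
  set P := D.toJordanDecomposition.posPart
  set N := D.toJordanDecomposition.negPart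
  have hmono : ∀ m : Measure ℝ, IsFiniteMeasure m → Monotone fun x => m.real (Iic x) :=
    fun m _ x y hxy => measureReal_mono (Iic_subset_Iic.2 hxy)
  have hloc : ∀ m : Measure ℝ, IsFiniteMeasure m →
      LocallyIntegrable fun x => m.real (Iic x) := fun m hm => (hmono m hm).locallyIntegrable
  have hPN : LocallyIntegrableOn (fun x => P.real (Iic x) - N.real (Iic x)) J :=
    ((hloc P inferInstance).sub (hloc N inferInstance)).locallyIntegrableOn J
  have hzero : ∀ φ, IsTestFunction J φ →
      ∫ x in J, (f - fun x => P.real (Iic x) - N.real (Iic x)) x * deriv φ x = 0 := by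
    intro φ hφ
    have hint : ∀ {k : ℝ → ℝ}, LocallyIntegrableOn k J →
        IntegrableOn (fun x => k x * deriv φ x) J :=
      fun hk => (hφ.deriv.integrable_mul hk).integrableOn
    have hφD : IntegrableOn φ J D.totalVariation :=
      (hφ.smooth.continuous.integrable_of_hasCompactSupport hφ.compactSupport).integrableOn
    have e1 : ∀ m : Measure ℝ, IsFiniteMeasure m →
        ∫ x in J, m.real (Iic x) * deriv φ x = - ∫ x in J, φ x ∂m := by
      intro m _
      rw [setIntegral_eq_integral_of_forall_compl_eq_zero (fun x hx =>
          mul_eq_zero_of_right _ (hφ.deriv.eq_zero_of_notMem hx)),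
        setIntegral_eq_integral_of_forall_compl_eq_zero (μ := m)
          (fun x hx => hφ.eq_zero_of_notMem hx)]
      exact integral_measureReal_Iic_mul_deriv m hφ.smooth hφ.compactSupport
    simp only [Pi.sub_apply, sub_mul]
    rw [integral_sub (hint h.locallyIntegrable), integral_sub, h.integral_eq φ hφ,
      setIntegral_signedMeasure_eq hJ.measurableSet hφD, e1 P inferInstance, e1 N inferInstance]
    · ring
    · exact hint ((hloc P inferInstance).locallyIntegrableOn J)
    · exact hint ((hloc N inferInstance).locallyIntegrableOn J)
    · have := hint hPN
      simp only [sub_mul] at this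
      exact this
  obtain ⟨c, hc⟩ := ae_eq_const_of_integral_mul_deriv_eq_zero hJ hJc
    (h.locallyIntegrable.sub hPN) hzero
  refine ⟨c, ?_⟩
  filter_upwards [hc] with x hx
  simp only [Pi.sub_apply] at hx
  linarith

theorem HasWeakDeriv.sub_eq_integral {J : Set ℝ} (hJ : IsOpen J) (hJc : J.OrdConnected)
    {f g : ℝ → ℝ} (h : HasWeakDeriv J f g) (hf : ContinuousOn f J) {x y : ℝ}
    (hx : x ∈ J) (hy : y ∈ J) : f y - f x = ∫ t in x..y, g t := by
  have hgi : ∀ {p q : ℝ}, p ∈ J → q ∈ J → IntervalIntegrable g volume p q := fun hp hq =>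
    (h.locallyIntegrable_deriv.integrableOn_compact_subset (hJc.uIcc_subset hp hq)
      isCompact_uIcc).intervalIntegrable
  -- `f` and the primitive `G` of `g` have the same weak derivative, so `f - G` is constant
  set G : ℝ → ℝ := fun y => ∫ t in x..y, g t with hG
  have hGc : ContinuousOn G J := by
    intro q hq
    obtain ⟨ε, hε, hball⟩ := Metric.isOpen_iff.1 hJ q hq
    have hl : q - ε / 2 ∈ J := hball (by
      rw [Metric.mem_ball, Real.dist_eq, abs_lt]; constructor <;> linarith)
    have hr : q + ε / 2 ∈ J := hball (by
      rw [Metric.mem_ball, Real.dist_eq, abs_lt]; constructor <;> linarith)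
    have hmin : min x (q - ε / 2) ∈ J := by rcases min_choice x (q - ε / 2) with h | h <;> simp [*]
    have hmax : max x (q + ε / 2) ∈ J := by rcases max_choice x (q + ε / 2) with h | h <;> simp [*]
    have h1 : ContinuousOn G (uIcc (min x (q - ε / 2)) (max x (q + ε / 2))) :=
      intervalIntegral.continuousOn_primitive_interval' (hgi hmin hmax) (by
        rw [uIcc_of_le (by simp)]
        exact ⟨min_le_left _ _, le_max_left _ _⟩)
    refine (h1.continuousAt ?_).continuousWithinAt
    rw [uIcc_of_le (by simp)]
    refine Icc_mem_nhds ?_ ?_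
    · exact (min_le_right _ _).trans_lt (by linarith)
    · exact lt_of_lt_of_le (by linarith) (le_max_right _ _)
  have hzero : ∀ φ, IsTestFunction J φ → ∫ x in J, (f - G) x * deriv φ x = 0 := by
    intro φ hφ
    obtain ⟨p, hp, q, hq, hpq, hsub⟩ := hφ.exists_tsupport_subset_Ioo hJ ⟨x, hx⟩
    have hout : ∀ t, t ∉ Ioo p q → φ t = 0 := fun t ht =>
      image_eq_zero_of_notMem_tsupport fun h => ht (hsub h)
    have hout' : ∀ t, t ∉ Ioo p q → deriv φ t = 0 := fun t ht =>
      image_eq_zero_of_notMem_tsupport fun h => ht (hsub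
        (tsupport_deriv_subset (f := φ) (𝕜 := ℝ) h))
    have hd : Continuous (deriv φ) := hφ.smooth.continuous_deriv (by simp)
    have hIJ : Ioc p q ⊆ J := Ioc_subset_Icc_self.trans (hJc.out hp hq)
    -- integrals over `J` against a test function reduce to integrals over `[p, q]`
    have red : ∀ k ψ : ℝ → ℝ, (∀ t, t ∉ Ioo p q → ψ t = 0) →
        ∫ t in J, k t * ψ t = ∫ t in p..q, k t * ψ t := by
      intro k ψ hψ
      rw [intervalIntegral.integral_of_le hpq.le,
        setIntegral_eq_of_subset_of_forall_sdiff_eq_zero hJ.measurableSet hIJ]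
      intro t ht
      rw [hψ t fun h => ht.2 ⟨h.1, h.2.le⟩, mul_zero]
    have hGpq : ∀ t ∈ uIcc p q, G t = G p + ∫ s in p..t, g s := by
      intro t ht
      have htJ : t ∈ J := hJc.uIcc_subset hp hq ht
      exact (intervalIntegral.integral_add_adjacent_intervals (hgi hx hp) (hgi hp htJ)).symm
    have hac := (hgi hp hq).absolutelyContinuousOnInterval_intervalIntegral (c := p) left_mem_uIcc
    have hφac : AbsolutelyContinuousOnInterval φ p q :=
      (hφ.smooth.of_le (by simp)).contDiffOn.absolutelyContinuousOnInterval
    have ibp := hac.integral_mul_deriv_eq_deriv_mul hφac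
    have hdg : ∫ t in p..q, deriv (fun x => ∫ v in p..x, g v) t * φ t = ∫ t in p..q, g t * φ t := by
      refine intervalIntegral.integral_congr_ae ?_
      filter_upwards [(hgi hp hq).ae_hasDerivAt_integral] with t ht htI
      rw [(ht (uIoc_subset_uIcc htI) p left_mem_uIcc).deriv]
    have hφd : ∫ t in p..q, deriv φ t = 0 := by
      rw [hφac.integral_deriv_eq_sub, hout q (by simp), hout p (by simp), sub_zero]
    have eG : ∫ t in J, G t * deriv φ t = - ∫ t in J, g t * φ t := by
      rw [red G _ hout', red g _ hout]
      have : ∫ t in p..q, G t * deriv φ t =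
          G p * (∫ t in p..q, deriv φ t) +
            ∫ t in p..q, (∫ v in p..t, g v) * deriv φ t := by
        rw [← intervalIntegral.integral_const_mul, ← intervalIntegral.integral_add]
        · refine intervalIntegral.integral_congr fun t ht => ?_
          rw [hGpq t ht]; ring
        · exact (hd.intervalIntegrable p q).const_mul _
        · exact (hac.continuousOn.mul hd.continuousOn).intervalIntegrable
      rw [this, hφd, ibp, hdg, hout q (by simp), hout p (by simp)]
      ring
    simp only [Pi.sub_apply, sub_mul]
    rw [integral_sub (hφ.deriv.integrable_mul h.locallyIntegrable |>.integrableOn) 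
      (hφ.deriv.integrable_mul (hGc.locallyIntegrableOn hJ.measurableSet)).integrableOn, eG,
      h.integral_eq φ hφ, sub_self]
  obtain ⟨c, hc⟩ := ae_eq_const_of_integral_mul_deriv_eq_zero hJ hJc
    (h.locallyIntegrable.sub (hGc.locallyIntegrableOn hJ.measurableSet)) hzero
  have heq : EqOn (f - G) (fun _ => c) J :=
    Measure.eqOn_open_of_ae_eq hc hJ (hf.sub hGc) continuousOn_const
  have h1 := heq hx
  have h2 := heq hy
  simp only [Pi.sub_apply, hG, intervalIntegral.integral_same] at h1 h2
  linarith

/-! ### The sign condition and the inequality at a fixed time -/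

/-- A function `z` with `|z| ≤ 1` pairs with `D` to at most the total variation of `D`, and
equality forces `z` to be the sign of `D`. -/
theorem setIntegral_signedMeasure_le_variation {D : SignedMeasure ℝ} {J : Set ℝ}
    (hJ : MeasurableSet J) {z : ℝ → ℝ} (hz : ContinuousOn z J) (hz1 : ∀ x ∈ J, |z x| ≤ 1) :
    ∫ᵛ x in J, z x ∂•D ≤ D.variation.real J ∧
      (∫ᵛ x in J, z x ∂•D = D.variation.real J →
        (∀ᵐ x ∂(D.toJordanDecomposition.posPart.restrict J), z x = 1) ∧
        ∀ᵐ x ∂(D.toJordanDecomposition.negPart.restrict J), z x = -1) := by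
  have hzi : ∀ m : Measure ℝ, IsFiniteMeasure m → IntegrableOn z J m := fun m _ =>
    Integrable.of_bound (hz.aestronglyMeasurable hJ) 1
      (by filter_upwards [ae_restrict_mem hJ] with x hx using hz1 x hx)
  rw [setIntegral_signedMeasure_eq hJ (hzi _ inferInstance),
    ← SignedMeasure.totalVariation_eq_variation, SignedMeasure.totalVariation,
    measureReal_add_apply]
  set P := D.toJordanDecomposition.posPart
  set N := D.toJordanDecomposition.negPart
  have hP1 : IntegrableOn (fun x => 1 - z x) J P := (integrable_const _).sub (hzi P inferInstance)
  have hN1 : IntegrableOn (fun x => 1 + z x) J N := (integrable_const _).add (hzi N inferInstance)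
  have eP : ∫ x in J, (1 - z x) ∂P = P.real J - ∫ x in J, z x ∂P := by
    rw [integral_sub (integrable_const _) (hzi P inferInstance)]; simp
  have eN : ∫ x in J, (1 + z x) ∂N = N.real J + ∫ x in J, z x ∂N := by
    rw [integral_add (integrable_const _) (hzi N inferInstance)]; simp
  have pP : 0 ≤ᵐ[P.restrict J] fun x => 1 - z x := by
    filter_upwards [ae_restrict_mem hJ] with x hx
    exact sub_nonneg.2 (abs_le.1 (hz1 x hx)).2
  have pN : 0 ≤ᵐ[N.restrict J] fun x => 1 + z x := by
    filter_upwards [ae_restrict_mem hJ] with x hx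
    change 0 ≤ 1 + z x
    linarith [(abs_le.1 (hz1 x hx)).1]
  have iP := integral_nonneg_of_ae pP
  have iN := integral_nonneg_of_ae pN
  refine ⟨by linarith, fun heq => ⟨?_, ?_⟩⟩
  · have := (integral_eq_zero_iff_of_nonneg_ae pP hP1).1 (by linarith)
    filter_upwards [this] with x hx
    simp only [Pi.zero_apply] at hx
    linarith
  · have := (integral_eq_zero_iff_of_nonneg_ae pN hN1).1 (by linarith)
    filter_upwards [this] with x hx
    simp only [Pi.zero_apply] at hx
    linarith

theorem exists_mem_of_measureReal_pos {m : Measure ℝ} {J s : Set ℝ} {p : ℝ → Prop}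
    (hs : MeasurableSet s) (hsJ : s ⊆ J) (h : ∀ᵐ x ∂(m.restrict J), p x) (h0 : 0 < m.real s) :
    ∃ x ∈ s, p x := by
  by_contra! hcon
  have h1 : ∀ᵐ x ∂(m.restrict s), p x := ae_restrict_of_ae_restrict_of_subset hsJ h
  have h2 : ∀ᵐ x ∂(m.restrict s), False := by
    filter_upwards [h1, ae_restrict_mem hs] with x hx hxs using hcon x hxs hx
  rw [Filter.eventually_false_iff_eq_bot, ae_eq_bot, Measure.restrict_eq_zero] at h2
  simp [measureReal_def, h2] at h0

/-- `F` is a representative on `J` of the function `f` of bounded variation, defined at every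
point, whose variation is dominated by that of the monotone function `V`, of total increase at most
`C` on `J`. Between any two points of `J` with a larger value of `F` at the right one, `z` takes
the value `1`, and between two points with a smaller value at the right one, it takes the value
`-1`: this is the condition "`z = Df / |Df|`" for a continuous `z`. -/
structure IsProfile (J : Set ℝ) (f z : ℝ → ℝ) (C : ℝ) (F V : ℝ → ℝ) : Prop where
  measurable : Measurable F
  monotone : Monotone V
  ae_eq : ∀ᵐ x ∂(volume.restrict J), f x = F x
  abs_sub_le : ∀ x y, x ≤ y → |F y - F x| ≤ V y - V x
  sub_le : ∀ x ∈ J, ∀ y ∈ J, x ≤ y → V y - V x ≤ C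
  up : ∀ x ∈ J, ∀ y ∈ J, x ≤ y → F x < F y → ∃ p ∈ Icc x y, z p = 1
  down : ∀ x ∈ J, ∀ y ∈ J, x ≤ y → F y < F x → ∃ p ∈ Icc x y, z p = -1

/-- The functions are `F = c + P - N` and `V = P + N`, where `P` and `N` are the distribution
functions of the positive and negative parts of `D`. -/
theorem HasBVDeriv.exists_isProfile {J : Set ℝ} (hJ : IsOpen J) (hJc : J.OrdConnected)
    {f z : ℝ → ℝ} {D : SignedMeasure ℝ} (h : HasBVDeriv J f D) (hz : ContinuousOn z J)
    (hz1 : ∀ x ∈ J, |z x| ≤ 1) (hp : ∫ᵛ x in J, z x ∂•D = D.variation.real J) :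
    ∃ F V : ℝ → ℝ, IsProfile J f z (D.variation.real J) F V := by
  obtain ⟨c, hc⟩ := h.exists_ae_eq hJ hJc
  obtain ⟨zP, zN⟩ := (setIntegral_signedMeasure_le_variation hJ.measurableSet hz hz1).2 hp
  rw [← SignedMeasure.totalVariation_eq_variation, SignedMeasure.totalVariation]
  set P := D.toJordanDecomposition.posPart
  set N := D.toJordanDecomposition.negPart
  have hIoc : ∀ m : Measure ℝ, IsFiniteMeasure m → ∀ x y : ℝ, x ≤ y →
      m.real (Iic y) - m.real (Iic x) = m.real (Ioc x y) := by
    intro m _ x y hxy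
    rw [← Iic_sdiff_Iic, measureReal_sdiff (Iic_subset_Iic.2 hxy) measurableSet_Iic]
  have hmono : ∀ m : Measure ℝ, IsFiniteMeasure m → Monotone fun x => m.real (Iic x) :=
    fun m _ x y hxy => measureReal_mono (Iic_subset_Iic.2 hxy)
  have hsub : ∀ x ∈ J, ∀ y ∈ J, Ioc x y ⊆ J := fun x hx y hy =>
    Ioc_subset_Icc_self.trans (hJc.out hx hy)
  refine ⟨fun x => c + (P.real (Iic x) - N.real (Iic x)), fun x => P.real (Iic x) + N.real (Iic x),
    ?_, (hmono P inferInstance).add (hmono N inferInstance), hc, ?_, ?_, ?_, ?_⟩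
  · exact measurable_const.add
      ((hmono P inferInstance).measurable.sub (hmono N inferInstance).measurable)
  · intro x y hxy
    have h1 := hmono P inferInstance hxy
    have h2 := hmono N inferInstance hxy
    simp only at h1 h2
    rw [abs_le]; constructor <;> linarith
  · intro x hx y hy hxy
    have h1 := hIoc P inferInstance x y hxy
    have h2 := hIoc N inferInstance x y hxy
    rw [measureReal_add_apply]
    have h3 : P.real (Ioc x y) ≤ P.real J := measureReal_mono (hsub x hx y hy)
    have h4 : N.real (Ioc x y) ≤ N.real J := measureReal_mono (hsub x hx y hy)
    linarith
  · intro x hx y hy hxy hlt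
    have h1 := hIoc P inferInstance x y hxy
    have h2 := hIoc N inferInstance x y hxy
    have h3 : 0 ≤ N.real (Ioc x y) := measureReal_nonneg
    obtain ⟨p, hp, h⟩ := exists_mem_of_measureReal_pos measurableSet_Ioc (hsub x hx y hy) zP
      (by linarith)
    exact ⟨p, Ioc_subset_Icc_self hp, h⟩
  · intro x hx y hy hxy hlt
    have h1 := hIoc P inferInstance x y hxy
    have h2 := hIoc N inferInstance x y hxy
    have h3 : 0 ≤ P.real (Ioc x y) := measureReal_nonneg
    obtain ⟨p, hp, h⟩ := exists_mem_of_measureReal_pos measurableSet_Ioc (hsub x hx y hy) zN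
      (by linarith)
    exact ⟨p, Ioc_subset_Icc_self hp, h⟩

/-- The truncated positive part `min r⁺ 1`. The truncation keeps all integrands below integrable,
as `g` is integrable on bounded sets. -/
noncomputable def ramp (r : ℝ) : ℝ := min (max r 0) 1

theorem ramp_nonneg (r : ℝ) : 0 ≤ ramp r := le_min (le_max_right _ _) zero_le_one

theorem ramp_le_one (r : ℝ) : ramp r ≤ 1 := min_le_right _ _

theorem ramp_of_nonpos {r : ℝ} (h : r ≤ 0) : ramp r = 0 := by simp [ramp, h]

theorem ramp_pos {r : ℝ} (h : 0 < r) : 0 < ramp r := by simp [ramp, h]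

theorem continuous_ramp : Continuous ramp := by unfold ramp; fun_prop

theorem ramp_mono : Monotone ramp := fun _ _ h => min_le_min_right _ (max_le_max_right _ h)

theorem abs_ramp_sub_le (r s : ℝ) : |ramp r - ramp s| ≤ |r - s| := by
  unfold ramp
  refine (abs_min_sub_min_le_max _ _ _ _).trans ?_
  rw [sub_self, abs_zero, max_eq_left (abs_nonneg _)]
  refine (abs_max_sub_max_le_max _ _ _ _).trans ?_
  simp

/-- For almost every `y`, the function `ramp (f x - f y - k)` of `x` vanishes at `x = y`, so
`integral_mul_nonpos_of_zero` applies to its pointwise representative. -/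
theorem IsProfile.integral_ramp_mul_nonpos {J : Set ℝ} {f z g F V : ℝ → ℝ} {C : ℝ}
    (hF : IsProfile J f z C F V) (hz1 : ∀ x ∈ J, |z x| ≤ 1)
    (hg : LocallyIntegrableOn g J)
    (hz : ∀ x ∈ J, ∀ y ∈ J, z y - z x = ∫ t in x..y, g t)
    {a b : ℝ} (hab : a ≤ b) (hJab : Icc a b ⊆ J) {k : ℝ} (hk : 0 ≤ k) :
    ∀ᵐ y ∂(volume.restrict (Ioc a b)),
      ∫ x in Ioc a b, ramp (f x - f y - k) * g x ≤ 0 := by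
  have hsub : Ioc a b ⊆ J := Ioc_subset_Icc_self.trans hJab
  have hae := ae_restrict_of_ae_restrict_of_subset hsub hF.ae_eq
  filter_upwards [hae, ae_restrict_mem measurableSet_Ioc] with y hy hyI
  have h1 : ∫ x in Ioc a b, ramp (f x - f y - k) * g x =
      ∫ x in a..b, ramp (F x - F y - k) * g x := by
    rw [intervalIntegral.integral_of_le hab]
    refine integral_congr_ae ?_
    filter_upwards [hae] with x hx
    rw [hx, hy]
  rw [h1]
  have hlt : ∀ {x x'}, ramp (F x - F y - k) < ramp (F x' - F y - k) → F x < F x' := by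
    intro x x' h
    by_contra! hcon
    exact absurd h (not_lt.2 (ramp_mono (by linarith)))
  refine integral_mul_nonpos_of_zero (w := fun x => ramp (F x - F y - k)) (z := z) (V := V)
    ?_ ?_ (fun x => ramp_nonneg _) hF.monotone ?_ (fun x hx => hz1 x (hJab hx))
    (fun x hx y hy _ => hz x (hJab hx) y (hJab hy)) ?_ ?_ (Ioc_subset_Icc_self hyI) ?_
  · rw [intervalIntegrable_iff, uIoc_of_le hab]
    exact (hg.integrableOn_compact_subset hJab isCompact_Icc).mono_set Ioc_subset_Icc_self
  · exact continuous_ramp.measurable.comp ((hF.measurable.sub_const _).sub_const _)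
  · intro x x' hxx'
    refine (abs_ramp_sub_le _ _).trans ?_
    have := hF.abs_sub_le x x' hxx'
    rwa [show F x' - F y - k - (F x - F y - k) = F x' - F x by ring]
  · exact fun x hx x' hx' hxx' h => hF.up x (hJab hx) x' (hJab hx') hxx' (hlt h)
  · exact fun x hx x' hx' hxx' h => hF.down x (hJab hx) x' (hJab hx') hxx' (hlt h)
  · exact ramp_of_nonpos (by linarith)

theorem IsProfile.neg {J : Set ℝ} {f z F V : ℝ → ℝ} {C : ℝ} (hF : IsProfile J f z C F V) :
    IsProfile J (fun x => -f x) (fun x => -z x) C (fun x => -F x) V where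
  measurable := hF.measurable.neg
  monotone := hF.monotone
  ae_eq := by filter_upwards [hF.ae_eq] with x hx; rw [hx]
  abs_sub_le x y hxy := by
    rw [show -F y - -F x = -(F y - F x) by ring, abs_neg]; exact hF.abs_sub_le x y hxy
  sub_le := hF.sub_le
  up x hx y hy hxy h := by
    obtain ⟨p, hp, h⟩ := hF.down x hx y hy hxy (neg_lt_neg_iff.1 h)
    exact ⟨p, hp, by rw [h, neg_neg]⟩
  down x hx y hy hxy h := by
    obtain ⟨p, hp, h⟩ := hF.up x hx y hy hxy (neg_lt_neg_iff.1 h)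
    exact ⟨p, hp, by rw [h]⟩

/-- The pairing is at most the total variation at almost every time, so equality of the time
integrals gives equality at almost every time. -/
theorem IsStrongSolutionWith.ae_pairing_eq {J : Set ℝ} (hJ : IsOpen J) {u₀ : ℝ → ℝ}
    {u z g : ℝ → ℝ → ℝ} {D : ℝ → SignedMeasure ℝ} (h : IsStrongSolutionWith J u₀ u z g D) :
    ∀ᵐ t ∂(volume.restrict (Ioi (0 : ℝ))),
      ∫ᵛ x in J, z t x ∂•(D t) = (D t).variation.real J := by
  have hT : ∀ n : ℕ, ∀ᵐ t ∂(volume.restrict (Ioc (0 : ℝ) (n + 1))),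
      ∫ᵛ x in J, z t x ∂•(D t) = (D t).variation.real J := by
    intro n
    have hn : (0 : ℝ) < n + 1 := by positivity
    have i1 := (h.intervalIntegrable_pairing _ hn).1
    have i2 := (h.intervalIntegrable_variation _ hn).1
    have e := h.integral_pairing_eq _ hn
    rw [intervalIntegral.integral_of_le hn.le, intervalIntegral.integral_of_le hn.le] at e
    have hle : ∀ᵐ t ∂(volume.restrict (Ioc (0 : ℝ) (n + 1))),
        ∫ᵛ x in J, z t x ∂•(D t) ≤ (D t).variation.real J := by
      have := ae_restrict_of_ae_restrict_of_subset (fun t ht => ht.1 : Ioc (0 : ℝ) (n + 1) ⊆ Ioi 0)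
        (h.continuousOn.and h.abs_le_one)
      filter_upwards [this] with t ht
      exact (setIntegral_signedMeasure_le_variation hJ.measurableSet ht.1 ht.2).1
    exact (integral_eq_iff_of_ae_le i1 i2 hle).1 e
  have hU : Ioi (0 : ℝ) = ⋃ n : ℕ, Ioc (0 : ℝ) (n + 1) := by
    ext t
    simp only [mem_Ioi, mem_iUnion, mem_Ioc]
    refine ⟨fun ht => ?_, fun ⟨_, h, _⟩ => h⟩
    obtain ⟨n, hn⟩ := exists_nat_ge t
    exact ⟨n, ht, by linarith⟩
  rw [hU, ae_restrict_iUnion_iff]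
  exact hT

/-! ### Integration in time -/

theorem _root_.LipschitzWith.comp_absolutelyContinuousOnInterval {ψ q : ℝ → ℝ} {C : ℝ≥0} {a b : ℝ}
    (hψ : LipschitzWith C ψ) (hq : AbsolutelyContinuousOnInterval q a b) :
    AbsolutelyContinuousOnInterval (fun s => ψ (q s)) a b := by
  have h := Filter.Tendsto.const_mul (C : ℝ) hq
  rw [mul_zero] at h
  refine squeeze_zero (fun E => Finset.sum_nonneg fun _ _ => dist_nonneg) (fun E => ?_) h
  rw [Finset.mul_sum]
  exact Finset.sum_le_sum fun i _ => hψ.dist_le_mul _ _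

theorem stronglyMeasurable_intervalIntegral_fst {h : ℝ × ℝ → ℝ} (hm : StronglyMeasurable h) :
    StronglyMeasurable fun p : ℝ × ℝ => ∫ r in (0 : ℝ)..p.1, h (r, p.2) := by
  have key : ∀ S : Set ((ℝ × ℝ) × ℝ), MeasurableSet S →
      StronglyMeasurable fun p : ℝ × ℝ =>
        ∫ r, S.indicator (fun q : (ℝ × ℝ) × ℝ => h (q.2, q.1.2)) (p, r) := by
    intro S hS
    refine StronglyMeasurable.integral_prod_right' (f := S.indicator _) ?_
    exact (hm.comp_measurable (g := fun q : (ℝ × ℝ) × ℝ => (q.2, q.1.2)) (by fun_prop)).indicator hS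
  have h1 := key {q | q.2 ∈ Ioc 0 q.1.1} (by
    simp only [mem_Ioc, ofPred_and]
    exact (measurableSet_lt measurable_const measurable_snd).inter
      (measurableSet_le measurable_snd (by fun_prop)))
  have h2 := key {q | q.2 ∈ Ioc q.1.1 0} (by
    simp only [mem_Ioc, ofPred_and]
    exact (measurableSet_lt (by fun_prop) measurable_snd).inter
      (measurableSet_le measurable_snd measurable_const))
  convert h1.sub h2 using 1
  ext p
  rw [Pi.sub_apply, intervalIntegral, ← integral_indicator measurableSet_Ioc,
    ← integral_indicator measurableSet_Ioc]
  rfl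

/-- Change of variables `∫ φ(q) q' = ∫ φ` along the absolutely continuous function
`q(s) = q₀ + ∫₀ˢ h`. -/
theorem integral_comp_mul_eq {φ h : ℝ → ℝ} (hφ : Continuous φ) {C : ℝ≥0} (hφC : ∀ r, |φ r| ≤ C)
    {T q₀ : ℝ} (hh : IntervalIntegrable h volume 0 T) :
    ∫ s in (0 : ℝ)..T, φ (q₀ + ∫ r in (0 : ℝ)..s, h r) * h s =
      ∫ r in q₀..(q₀ + ∫ r in (0 : ℝ)..T, h r), φ r := by
  set q : ℝ → ℝ := fun s => q₀ + ∫ r in (0 : ℝ)..s, h r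
  set ψ : ℝ → ℝ := fun y => ∫ r in q₀..y, φ r
  have hψ : ∀ y, HasDerivAt ψ (φ y) y := fun y => (hφ.integral_hasStrictDerivAt q₀ y).hasDerivAt
  have hlip : LipschitzWith C ψ := lipschitzWith_of_nnnorm_deriv_le
    (fun y => (hψ y).differentiableAt) fun y => by
      rw [(hψ y).deriv, ← NNReal.coe_le_coe, coe_nnnorm]; exact hφC y
  have hac := hh.absolutelyContinuousOnInterval_intervalIntegral (c := 0) left_mem_uIcc
  have hqac : AbsolutelyContinuousOnInterval q 0 T :=
    (LipschitzWith.const q₀).lipschitzOnWith.absolutelyContinuousOnInterval.add hac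
  have hcomp : AbsolutelyContinuousOnInterval (fun s => ψ (q s)) 0 T :=
    hlip.comp_absolutelyContinuousOnInterval hqac
  have e := hcomp.integral_deriv_eq_sub
  have e2 : ∫ s in (0 : ℝ)..T, deriv (fun s => ψ (q s)) s =
      ∫ s in (0 : ℝ)..T, φ (q s) * h s := by
    refine intervalIntegral.integral_congr_ae ?_
    filter_upwards [hh.ae_hasDerivAt_integral] with s hs hsI
    have h1 : HasDerivAt q (h s) s :=
      (hs (uIoc_subset_uIcc hsI) 0 left_mem_uIcc).const_add q₀
    exact ((hψ (q s)).comp s h1).deriv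
  rw [← e2, e]
  simp [ψ, q]

/-- Let `U(s, x) = v(x) + ∫₀ˢ h(r, x) dr`. If
`∬ φ(U(s,x) - U(s,y) - k) (h(s,x) - h(s,y)) dx dy ≤ 0` for almost every `s`, where `φ` is `ramp`,
then the bound `v(x) - v(y) ≤ k` persists up to time `T`: the integral of the primitive of `φ` at
`U(T,x) - U(T,y) - k` is nonpositive. The two terms of the double integral are assumed nonpositive
separately, for the integration in one variable. -/
theorem ae_sub_le_of_ae_integral_nonpos {μ : Measure ℝ} [IsFiniteMeasure μ] {T k : ℝ}
    (hT : 0 ≤ T) {h : ℝ × ℝ → ℝ} (hm : StronglyMeasurable h)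
    (hint : Integrable h ((volume.restrict (Ioc 0 T)).prod μ))
    {v : ℝ → ℝ} {U : ℝ → ℝ → ℝ} (hv : Measurable v)
    (hU : ∀ s x, U s x = v x + ∫ r in (0 : ℝ)..s, h (r, x))
    (hvk : ∀ᵐ p ∂μ.prod μ, v p.1 - v p.2 ≤ k)
    (hs : ∀ᵐ s ∂(volume.restrict (Ioc 0 T)),
      (∀ᵐ y ∂μ, ∫ x, ramp (U s x - U s y - k) * h (s, x) ∂μ ≤ 0) ∧
      ∀ᵐ x ∂μ, ∫ y, ramp (U s x - U s y - k) * -h (s, y) ∂μ ≤ 0) :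
    ∀ᵐ p ∂μ.prod μ, U T p.1 - U T p.2 ≤ k := by
  set θ := volume.restrict (Ioc (0 : ℝ) T)
  have hUm : StronglyMeasurable (fun p : ℝ × ℝ => U p.1 p.2) := by
    simp only [hU]
    exact (hv.stronglyMeasurable.comp_measurable measurable_snd).add
      (stronglyMeasurable_intervalIntegral_fst hm)
  have hramp : StronglyMeasurable fun q : ℝ × ℝ × ℝ => ramp (U q.1 q.2.1 - U q.1 q.2.2 - k) := by
    refine continuous_ramp.comp_stronglyMeasurable ?_
    refine StronglyMeasurable.sub (StronglyMeasurable.sub ?_ ?_) stronglyMeasurable_const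
    · exact hUm.comp_measurable (g := fun q : ℝ × ℝ × ℝ => (q.1, q.2.1)) (by fun_prop)
    · exact hUm.comp_measurable (g := fun q : ℝ × ℝ × ℝ => (q.1, q.2.2)) (by fun_prop)
  have hbd : ∀ q : ℝ × ℝ × ℝ, ‖ramp (U q.1 q.2.1 - U q.1 q.2.2 - k)‖ ≤ 1 := fun q => by
    rw [Real.norm_eq_abs, abs_of_nonneg (ramp_nonneg _)]; exact ramp_le_one _
  have hi1 : Integrable (fun q : ℝ × ℝ × ℝ => h (q.1, q.2.1)) (θ.prod (μ.prod μ)) :=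
    (measurePreserving_prodAssoc θ μ μ).symm.integrable_comp_of_integrable (hint.comp_fst μ)
  have hi2 : Integrable (fun q : ℝ × ℝ × ℝ => h (q.1, q.2.2)) (θ.prod (μ.prod μ)) :=
    ((MeasurePreserving.id θ).prod (Measure.measurePreserving_swap (μ := μ)
      (ν := μ))).integrable_comp_of_integrable hi1
  have hA : Integrable (fun q : ℝ × ℝ × ℝ => ramp (U q.1 q.2.1 - U q.1 q.2.2 - k) * h (q.1, q.2.1))
      (θ.prod (μ.prod μ)) :=
    hi1.bdd_mul hramp.aestronglyMeasurable (Filter.Eventually.of_forall hbd)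
  have hB : Integrable (fun q : ℝ × ℝ × ℝ => ramp (U q.1 q.2.1 - U q.1 q.2.2 - k) * -h (q.1, q.2.2))
      (θ.prod (μ.prod μ)) :=
    hi2.neg.bdd_mul hramp.aestronglyMeasurable (Filter.Eventually.of_forall hbd)
  set Φ : ℝ × ℝ × ℝ → ℝ := fun q =>
    ramp (U q.1 q.2.1 - U q.1 q.2.2 - k) * (h (q.1, q.2.1) - h (q.1, q.2.2)) with hΦ
  have hΦAB : ∀ q : ℝ × ℝ × ℝ, Φ q = ramp (U q.1 q.2.1 - U q.1 q.2.2 - k) * h (q.1, q.2.1) +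
      ramp (U q.1 q.2.1 - U q.1 q.2.2 - k) * -h (q.1, q.2.2) := fun q => by
    simp only [hΦ]; ring
  have hΦi : Integrable Φ (θ.prod (μ.prod μ)) :=
    (hA.add hB).congr (Filter.Eventually.of_forall fun q => (hΦAB q).symm)
  -- the space integral at a fixed time is nonpositive
  have hspace : ∀ᵐ s ∂θ, ∫ p, Φ (s, p) ∂μ.prod μ ≤ 0 := by
    filter_upwards [hs, hA.prod_right_ae, hB.prod_right_ae] with s hs hAs hBs
    have e : ∫ p, Φ (s, p) ∂μ.prod μ =
        (∫ p : ℝ × ℝ, ramp (U s p.1 - U s p.2 - k) * h (s, p.1) ∂μ.prod μ) +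
          ∫ p : ℝ × ℝ, ramp (U s p.1 - U s p.2 - k) * -h (s, p.2) ∂μ.prod μ := by
      rw [← integral_add hAs hBs]
      exact integral_congr_ae (Filter.Eventually.of_forall fun p => hΦAB (s, p))
    rw [e, integral_prod_symm _ hAs, integral_prod _ hBs]
    exact add_nonpos (integral_nonpos_of_ae hs.1) (integral_nonpos_of_ae hs.2)
  -- the time integral at a fixed pair of points is a primitive of `ramp`
  have hx : ∀ᵐ x ∂μ, IntervalIntegrable (fun s => h (s, x)) volume 0 T := by
    filter_upwards [hint.prod_left_ae] with x hx
    rwa [intervalIntegrable_iff, uIoc_of_le hT]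
  have htime : ∀ᵐ p ∂μ.prod μ, ∫ s, Φ (s, p) ∂θ =
      ∫ r in (v p.1 - v p.2 - k)..(U T p.1 - U T p.2 - k), ramp r := by
    filter_upwards [Measure.quasiMeasurePreserving_fst.ae hx,
      Measure.quasiMeasurePreserving_snd.ae hx] with p h1 h2
    have hsplit : ∀ s ∈ Icc 0 T, U s p.1 - U s p.2 - k =
        (v p.1 - v p.2 - k) + ∫ r in (0 : ℝ)..s, (h (r, p.1) - h (r, p.2)) := by
      intro s hs
      have hss : uIcc 0 s ⊆ uIcc 0 T := by
        rw [uIcc_of_le hs.1, uIcc_of_le hT]; exact Icc_subset_Icc_right hs.2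
      rw [hU, hU, intervalIntegral.integral_sub (h1.mono_set hss) (h2.mono_set hss)]
      ring
    rw [hsplit T ⟨hT, le_rfl⟩, ← integral_comp_mul_eq continuous_ramp (C := 1) ?_ (h1.sub h2),
      intervalIntegral.integral_of_le hT]
    · refine setIntegral_congr_fun measurableSet_Ioc fun s hs => ?_
      simp only [hΦ]
      rw [hsplit s (Ioc_subset_Icc_self hs)]
    · intro r
      rw [abs_of_nonneg (ramp_nonneg r)]; exact ramp_le_one r
  -- the primitive is nonnegative, and positive past `0`
  have hprim : ∀ᵐ p ∂μ.prod μ, ∫ s, Φ (s, p) ∂θ =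
      ∫ r in (0 : ℝ)..(U T p.1 - U T p.2 - k), ramp r := by
    filter_upwards [htime, hvk] with p hp hpk
    have hz : ∫ r in (v p.1 - v p.2 - k)..0, ramp r = 0 := by
      refine intervalIntegral.integral_zero_ae (Filter.Eventually.of_forall fun r hr => ?_)
      rw [uIoc_of_le (by linarith)] at hr
      exact ramp_of_nonpos hr.2
    rw [hp, ← intervalIntegral.integral_add_adjacent_intervals
      (continuous_ramp.intervalIntegrable _ 0) (continuous_ramp.intervalIntegrable 0 _), hz,
      zero_add]
  have hprim_pos : ∀ {y : ℝ}, 0 < y → 0 < ∫ r in (0 : ℝ)..y, ramp r := fun hy =>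
    intervalIntegral.intervalIntegral_pos_of_pos_on (continuous_ramp.intervalIntegrable _ _)
      (fun r hr => ramp_pos hr.1) hy
  have hprim_nonneg : ∀ y : ℝ, 0 ≤ ∫ r in (0 : ℝ)..y, ramp r := by
    intro y
    rcases le_total 0 y with hy | hy
    · exact intervalIntegral.integral_nonneg hy fun r _ => ramp_nonneg r
    · refine (intervalIntegral.integral_zero_ae (Filter.Eventually.of_forall fun r hr => ?_)).ge
      rw [uIoc_of_ge hy] at hr
      exact ramp_of_nonpos hr.2
  have hnn : 0 ≤ᵐ[μ.prod μ] fun p => ∫ s, Φ (s, p) ∂θ := by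
    filter_upwards [hprim] with p hp
    rw [Pi.zero_apply, hp]
    exact hprim_nonneg _
  have hzero : ∫ p, ∫ s, Φ (s, p) ∂θ ∂μ.prod μ = 0 := by
    refine le_antisymm ?_ (integral_nonneg_of_ae hnn)
    rw [← integral_prod_symm _ hΦi, integral_prod _ hΦi]
    exact integral_nonpos_of_ae hspace
  have := (integral_eq_zero_iff_of_nonneg_ae hnn hΦi.integral_prod_right).1 hzero
  filter_upwards [this, hprim] with p h0 hp
  by_contra! hcon
  have hpos := hprim_pos (sub_pos.2 hcon)
  rw [← hp, h0] at hpos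
  exact lt_irrefl _ hpos

/-! ### Oscillation bounds for strong solutions -/

theorem IsStrongSolutionWith.ae_exists_isProfile {J : Set ℝ} (hJ : IsOpen J)
    (hJc : J.OrdConnected) {u₀ : ℝ → ℝ} {u z g : ℝ → ℝ → ℝ} {D : ℝ → SignedMeasure ℝ}
    (h : IsStrongSolutionWith J u₀ u z g D) :
    ∃ C : ℝ, ∀ᵐ t ∂(volume.restrict (Ioi (0 : ℝ))), ∃ F V : ℝ → ℝ,
      IsProfile J (u t) (z t) C F V := by
  obtain ⟨C, hC⟩ := h.variation_le
  refine ⟨C, ?_⟩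
  filter_upwards [hC, h.hasBVDeriv, h.continuousOn, h.abs_le_one, h.ae_pairing_eq hJ]
    with t hCt hBV hz hz1 hp
  obtain ⟨F, V, hF⟩ := hBV.exists_isProfile hJ hJc hz hz1 hp
  refine ⟨F, V, { hF with sub_le := fun x hx y hy hxy => (hF.sub_le x hx y hy hxy).trans ?_ }⟩
  exact ENNReal.toReal_le_coe_of_le_coe hCt

theorem IsStrongSolutionWith.integrable_restrict {J : Set ℝ} {u₀ : ℝ → ℝ}
    {u z g : ℝ → ℝ → ℝ} {D : ℝ → SignedMeasure ℝ} (h : IsStrongSolutionWith J u₀ u z g D)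
    {a b : ℝ} (hab : Ioc a b ⊆ J) {T : ℝ} (hT : 0 < T) :
    Integrable (Function.uncurry g)
      ((volume.restrict (Ioc 0 T)).prod (volume.restrict (Ioc a b))) := by
  have h1 := h.memLp T hT
  rw [restrict_Ioo_eq_restrict_Ioc] at h1
  exact (h1.mono_measure (Measure.prod_mono le_rfl (Measure.restrict_mono hab le_rfl))).integrable
    (by norm_num)

/-- The oscillation of a strong solution over an interval does not increase. No boundary condition
at `a` and `b` is involved. -/
theorem IsStrongSolutionWith.ae_sub_le {J : Set ℝ} (hJ : IsOpen J) (hJc : J.OrdConnected)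
    {u₀ : ℝ → ℝ} {u z g : ℝ → ℝ → ℝ} {D : ℝ → SignedMeasure ℝ}
    (h : IsStrongSolutionWith J u₀ u z g D) {a b : ℝ} (hab : a ≤ b) (hJab : Icc a b ⊆ J)
    (hu₀ : ContinuousOn u₀ (Icc a b)) {k : ℝ} (hk : 0 ≤ k)
    (hk₀ : ∀ x ∈ Icc a b, ∀ y ∈ Icc a b, u₀ x - u₀ y ≤ k) {t : ℝ} (ht : 0 ≤ t) :
    ∀ᵐ p ∂(volume.restrict (Ioc a b)).prod (volume.restrict (Ioc a b)),
      u t p.1 - u t p.2 ≤ k := by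
  have hsub : Ioc a b ⊆ J := Ioc_subset_Icc_self.trans hJab
  have heq : ∀ s, 0 ≤ s → ∀ᵐ x ∂(volume.restrict (Ioc a b)),
      u s x = u₀ x + ∫ r in (0 : ℝ)..s, g r x := fun s hs =>
    ae_restrict_of_ae_restrict_of_subset hsub (h.eq_add_integral s hs)
  have hmem : ∀ᵐ x ∂(volume.restrict (Ioc a b)), x ∈ Icc a b := by
    filter_upwards [ae_restrict_mem measurableSet_Ioc] with x hx using Ioc_subset_Icc_self hx
  have hu₀m : AEMeasurable u₀ (volume.restrict (Ioc a b)) :=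
    ((hu₀.mono Ioc_subset_Icc_self).aestronglyMeasurable measurableSet_Ioc).aemeasurable
  rcases ht.eq_or_lt with rfl | ht0
  · have h0 : ∀ᵐ x ∂(volume.restrict (Ioc a b)), u 0 x = u₀ x ∧ x ∈ Icc a b := by
      filter_upwards [heq 0 le_rfl, hmem] with x hx hx'
      exact ⟨by simpa using hx, hx'⟩
    filter_upwards [Measure.quasiMeasurePreserving_fst.ae h0,
      Measure.quasiMeasurePreserving_snd.ae h0] with p h1 h2
    rw [h1.1, h2.1]
    exact hk₀ _ h1.2 _ h2.2
  set μ : Measure ℝ := volume.restrict (Ioc a b)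
  have hG := h.integrable_restrict hsub ht0
  -- jointly measurable versions of `g` and `u₀`, so that Fubini's theorem applies
  obtain ⟨G, hGm, hGg⟩ := hG.1
  set v := hu₀m.mk u₀
  have hv : ∀ᵐ x ∂μ, u₀ x = v x := hu₀m.ae_eq_mk
  have hg1 : ∀ᵐ s ∂(volume.restrict (Ioc 0 t)), ∀ᵐ x ∂μ, g s x = G (s, x) :=
    Measure.ae_ae_of_ae_prod hGg
  have hg2 : ∀ᵐ x ∂μ, ∀ᵐ s ∂(volume.restrict (Ioc 0 t)), g s x = G (s, x) :=
    Measure.ae_ae_of_ae_prod (Measure.measurePreserving_swap.quasiMeasurePreserving.ae hGg)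
  have hU : ∀ s, 0 ≤ s → s ≤ t → ∀ᵐ x ∂μ, u s x = v x + ∫ r in (0 : ℝ)..s, G (r, x) := by
    intro s hs0 hst
    filter_upwards [heq s hs0, hv, hg2] with x h1 h2 h3
    rw [h1, h2, intervalIntegral.integral_of_le hs0, intervalIntegral.integral_of_le hs0]
    congr 1
    exact integral_congr_ae
      (ae_restrict_of_ae_restrict_of_subset (Ioc_subset_Ioc_right hst) h3)
  have main := ae_sub_le_of_ae_integral_nonpos (μ := μ) (T := t) (k := k) ht hGm (hG.congr hGg)
    (v := v) (U := fun s x => v x + ∫ r in (0 : ℝ)..s, G (r, x)) hu₀m.measurable_mk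
    (fun _ _ => rfl) ?_ ?_
  · filter_upwards [main, Measure.quasiMeasurePreserving_fst.ae (hU t ht le_rfl),
      Measure.quasiMeasurePreserving_snd.ae (hU t ht le_rfl)] with p h1 h2 h3
    rw [h2, h3]; exact h1
  · have hv' : ∀ᵐ x ∂μ, u₀ x = v x ∧ x ∈ Icc a b := hv.and hmem
    filter_upwards [Measure.quasiMeasurePreserving_fst.ae hv',
      Measure.quasiMeasurePreserving_snd.ae hv'] with p h1 h2
    rw [← h1.1, ← h2.1]
    exact hk₀ _ h1.2 _ h2.2
  obtain ⟨C, hC⟩ := h.ae_exists_isProfile hJ hJc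
  have hpos : Ioc 0 t ⊆ Ioi 0 := fun s hs => hs.1
  filter_upwards [hg1, ae_restrict_mem measurableSet_Ioc,
    ae_restrict_of_ae_restrict_of_subset hpos hC,
    ae_restrict_of_ae_restrict_of_subset hpos h.continuousOn,
    ae_restrict_of_ae_restrict_of_subset hpos h.abs_le_one,
    ae_restrict_of_ae_restrict_of_subset hpos h.hasWeakDeriv] with s hgs hs hFV hz hz1 hw
  obtain ⟨F, V, hF⟩ := hFV
  have hprim : ∀ x ∈ J, ∀ y ∈ J, z s y - z s x = ∫ r in x..y, g s r := fun x hx y hy =>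
    hw.sub_eq_integral hJ hJc hz hx hy
  have i1 := hF.integral_ramp_mul_nonpos hz1 hw.locallyIntegrable_deriv hprim hab hJab hk
  have i2 := hF.neg.integral_ramp_mul_nonpos (g := fun x => -g s x)
    (fun x hx => by rw [abs_neg]; exact hz1 x hx) hw.locallyIntegrable_deriv.neg
    (fun x hx y hy => by rw [intervalIntegral.integral_neg, ← hprim x hx y hy]; ring) hab hJab hk
  have hUs := hU s hs.1.le hs.2
  constructor
  · filter_upwards [i1, hUs] with y hy hy'
    refine le_of_eq_of_le (integral_congr_ae ?_) hy
    filter_upwards [hUs, hgs] with x hx hx'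
    rw [hx, hy', hx']
  · filter_upwards [i2, hUs] with y hy hy'
    refine le_of_eq_of_le (integral_congr_ae ?_) hy
    filter_upwards [hUs, hgs] with x hx hx'
    rw [hx, hy', hx']
    congr 2; ring

theorem subset_closure_of_ae_mem {I E : Set ℝ} (hI : IsOpen I)
    (hE : ∀ᵐ x ∂(volume.restrict I), x ∈ E) : I ⊆ closure (E ∩ I) := by
  intro x hx
  rw [mem_closure_iff]
  intro o ho hxo
  by_contra hcon
  rw [not_nonempty_iff_eq_empty] at hcon
  have h0 : volume (o ∩ I) = 0 := by
    rw [ae_restrict_iff' hI.measurableSet] at hE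
    have hempty : o ∩ I ⊆ {y | y ∈ I → y ∈ E}ᶜ := by
      intro y hy hyE
      have : y ∈ o ∩ (E ∩ I) := ⟨hy.1, hyE hy.2, hy.2⟩
      simp [hcon] at this
    exact measure_mono_null hempty (mem_ae_iff.1 hE)
  exact (ho.inter hI).measure_ne_zero volume ⟨x, hxo, hx⟩ h0

/-- A bound on the oscillation over a dense subset holds everywhere for a continuous function. -/
theorem sub_le_of_subset_closure {I A : Set ℝ} {v : ℝ → ℝ} {k : ℝ} (hv : ContinuousOn v I)
    (hAI : A ⊆ I) (hIA : I ⊆ closure A) (h : ∀ x ∈ A, ∀ y ∈ A, v x - v y ≤ k) :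
    ∀ x ∈ I, ∀ y ∈ I, v x - v y ≤ k := by
  have step : ∀ x ∈ I, ∀ y ∈ A, v x - v y ≤ k := by
    intro x hx y hy
    have := mem_closure_iff_nhdsWithin_neBot.1 (hIA hx)
    refine le_of_tendsto (((hv x hx).mono hAI).sub_const (v y)) ?_
    filter_upwards [self_mem_nhdsWithin] with x' hx' using h x' hx' y hy
  intro x hx y hy
  have := mem_closure_iff_nhdsWithin_neBot.1 (hIA hy)
  refine le_of_tendsto (((hv y hy).mono hAI).const_sub (v x)) ?_
  filter_upwards [self_mem_nhdsWithin] with y' hy' using step x hx y' hy'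

theorem exists_rat_Icc_subset {I : Set ℝ} (hI : IsOpen I) (hIc : I.OrdConnected) {x y : ℝ}
    (hx : x ∈ I) (hy : y ∈ I) : ∃ a b : ℚ, Icc (a : ℝ) b ⊆ I ∧ x ∈ Ioo (a : ℝ) b ∧
      y ∈ Ioo (a : ℝ) b := by
  have hm : min x y ∈ I := by rcases min_choice x y with h | h <;> simp [*]
  have hM : max x y ∈ I := by rcases max_choice x y with h | h <;> simp [*]
  obtain ⟨ε, hε, hball⟩ := Metric.isOpen_iff.1 hI _ hm
  obtain ⟨δ, hδ, hball'⟩ := Metric.isOpen_iff.1 hI _ hM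
  obtain ⟨a, ha1, ha2⟩ := exists_rat_btwn (show min x y - ε < min x y by linarith)
  obtain ⟨b, hb1, hb2⟩ := exists_rat_btwn (show max x y < max x y + δ by linarith)
  have ha : (a : ℝ) ∈ I := hball (by
    rw [Metric.mem_ball, Real.dist_eq, abs_lt]; constructor <;> linarith)
  have hb : (b : ℝ) ∈ I := hball' (by
    rw [Metric.mem_ball, Real.dist_eq, abs_lt]; constructor <;> linarith)
  exact ⟨a, b, hIc.out ha hb,
    ⟨ha2.trans_le (min_le_left _ _), (le_max_left _ _).trans_lt hb1⟩,
    ⟨ha2.trans_le (min_le_right _ _), (le_max_right _ _).trans_lt hb1⟩⟩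

/-- The oscillation of `u₀` over `I` is at most the essential bound of `|Du(t)|(J)`, by lower
semicontinuity as `t → 0`. -/
theorem IsStrongSolutionWith.exists_sub_le {J : Set ℝ} (hJ : IsOpen J) (hJc : J.OrdConnected)
    {u₀ : ℝ → ℝ} {u z g : ℝ → ℝ → ℝ} {D : ℝ → SignedMeasure ℝ}
    (h : IsStrongSolutionWith J u₀ u z g D) {I : Set ℝ} (hI : IsOpen I) (hIc : I.OrdConnected)
    (hIJ : I ⊆ J) (hcont : ContinuousOn u₀ I) :
    ∃ C : ℝ, ∀ x ∈ I, ∀ y ∈ I, u₀ x - u₀ y ≤ C := by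
  obtain ⟨C, hC⟩ := h.ae_exists_isProfile hJ hJc
  refine ⟨C, fun x hx y hy => ?_⟩
  obtain ⟨a, b, hab, hxab, hyab⟩ := exists_rat_Icc_subset hI hIc hx hy
  have hsub : Ioo (a : ℝ) b ⊆ J := Ioo_subset_Icc_self.trans (hab.trans hIJ)
  -- good times decreasing to `0`
  have hex : ∀ n : ℕ, ∃ t : ℝ, t ∈ Ioo (0 : ℝ) (1 / (n + 1)) ∧
      ∃ F V : ℝ → ℝ, IsProfile J (u t) (z t) C F V := by
    intro n
    have hn : (0 : ℝ) < 1 / (n + 1) := by positivity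
    have hne : (volume.restrict (Ioo (0 : ℝ) (1 / (n + 1)))) ≠ 0 := by
      rw [Ne, Measure.restrict_eq_zero, Real.volume_Ioo]
      simpa using hn
    have := ae_neBot.2 hne
    have h1 : ∀ᵐ t ∂(volume.restrict (Ioo (0 : ℝ) (1 / (n + 1)))),
        ∃ F V : ℝ → ℝ, IsProfile J (u t) (z t) C F V :=
      ae_restrict_of_ae_restrict_of_subset (fun s hs => hs.1) hC
    exact ((ae_restrict_mem measurableSet_Ioo).and h1).exists
  choose t htn F V hF using hex
  have hIoc : Ioc (a : ℝ) b ⊆ J := Ioc_subset_Icc_self.trans (hab.trans hIJ)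
  have hint : ∀ᵐ x ∂(volume.restrict (Ioo (a : ℝ) b)),
      IntervalIntegrable (fun s => g s x) volume 0 1 := by
    have := (h.integrable_restrict hIoc one_pos).prod_left_ae
    rw [← restrict_Ioo_eq_restrict_Ioc (a := (a : ℝ))] at this
    filter_upwards [this] with x hx
    rwa [intervalIntegrable_iff, uIoc_of_le zero_le_one]
  have hE : ∀ᵐ x ∂(volume.restrict (Ioo (a : ℝ) b)),
      x ∈ {x | IntervalIntegrable (fun s => g s x) volume 0 1 ∧
        ∀ n, u₀ x + (∫ r in (0 : ℝ)..t n, g r x) = F n x} := by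
    have h1 : ∀ᵐ x ∂(volume.restrict (Ioo (a : ℝ) b)), ∀ n,
        u₀ x + (∫ r in (0 : ℝ)..t n, g r x) = F n x := by
      rw [ae_all_iff]
      intro n
      filter_upwards [ae_restrict_of_ae_restrict_of_subset hsub (h.eq_add_integral (t n)
        (htn n).1.le), ae_restrict_of_ae_restrict_of_subset hsub (hF n).ae_eq] with x hx hx'
      rw [← hx, hx']
    exact hint.and h1
  have htz : Filter.Tendsto t Filter.atTop (nhds 0) :=
    squeeze_zero (fun n => (htn n).1.le) (fun n => (htn n).2.le)
      tendsto_one_div_add_atTop_nhds_zero_nat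
  have hlim : ∀ x, IntervalIntegrable (fun s => g s x) volume 0 1 →
      Filter.Tendsto (fun n => u₀ x + ∫ r in (0 : ℝ)..t n, g r x) Filter.atTop (nhds (u₀ x)) := by
    intro x hx
    have hc := intervalIntegral.continuousOn_primitive_interval' hx left_mem_uIcc 0 left_mem_uIcc
    have ht' : Filter.Tendsto t Filter.atTop (nhdsWithin 0 (uIcc 0 1)) := by
      refine tendsto_nhdsWithin_iff.2 ⟨htz, Filter.Eventually.of_forall fun n => ?_⟩
      rw [uIcc_of_le zero_le_one]
      refine ⟨(htn n).1.le, (htn n).2.le.trans ?_⟩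
      rw [div_le_one (by positivity)]
      linarith [n.cast_nonneg (α := ℝ)]
    have := (hc.tendsto.comp ht').const_add (u₀ x)
    simpa using this
  have hcl := subset_closure_of_ae_mem isOpen_Ioo hE
  refine sub_le_of_subset_closure (hcont.mono (Ioo_subset_Icc_self.trans hab)) inter_subset_right
    hcl ?_ x hxab y hyab
  rintro x ⟨⟨hx1, hx2⟩, hxI⟩ y ⟨⟨hy1, hy2⟩, hyI⟩
  refine le_of_tendsto ((hlim x hx1).sub (hlim y hy1)) (Filter.Eventually.of_forall fun n => ?_)
  rw [hx2, hy2]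
  rcases le_total x y with hxy | hxy
  · have h1 := (hF n).abs_sub_le x y hxy
    have h2 := (hF n).sub_le x (hsub hxI) y (hsub hyI) hxy
    linarith [(abs_le.1 h1).1]
  · have h1 := (hF n).abs_sub_le y x hxy
    have h2 := (hF n).sub_le y (hsub hyI) x (hsub hxI) hxy
    linarith [(abs_le.1 h1).2]

/-! ### The continuous representative -/

/-- A bound for almost every pair of points holds for all pairs of points of a set `E` of full
measure. For almost every `x` the number `f x - k` is an essential lower bound of `f`, and almost
every `f y` is at least every rational essential lower bound; the set `E` collects the points with
both properties. -/
theorem exists_ae_mem_forall_sub_le {μ : Measure ℝ} [SFinite μ] {f : ℝ → ℝ} {k : ℝ}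
    (h : ∀ᵐ p ∂μ.prod μ, f p.1 - f p.2 ≤ k) :
    ∃ E : Set ℝ, (∀ᵐ x ∂μ, x ∈ E) ∧ ∀ x ∈ E, ∀ y ∈ E, f x - f y ≤ k := by
  have h1 : ∀ᵐ x ∂μ, ∀ᵐ y ∂μ, f x - f y ≤ k := Measure.ae_ae_of_ae_prod h
  have h2 : ∀ᵐ y ∂μ, ∀ r : ℚ, (∀ᵐ y' ∂μ, (r : ℝ) ≤ f y') → (r : ℝ) ≤ f y := by
    rw [ae_all_iff]
    intro r
    by_cases hr : ∀ᵐ y' ∂μ, (r : ℝ) ≤ f y'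
    · filter_upwards [hr] with y hy _ using hy
    · exact Filter.Eventually.of_forall fun _ h => absurd h hr
  refine ⟨{x | (∀ᵐ y ∂μ, f x - f y ≤ k) ∧
    ∀ r : ℚ, (∀ᵐ y' ∂μ, (r : ℝ) ≤ f y') → (r : ℝ) ≤ f x}, h1.and h2, ?_⟩
  rintro x ⟨hx, -⟩ y ⟨-, hy⟩
  by_contra! hcon
  obtain ⟨r, hr1, hr2⟩ := exists_rat_btwn (show f y < f x - k by linarith)
  refine absurd (hy r ?_) (not_le.2 hr1)
  filter_upwards [hx] with y' hy'
  linarith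

/-- A function whose essential oscillation over every compact subinterval of `I` is at most that of
the continuous function `u₀` has a continuous representative on `I` with the same property over
`I`. -/
theorem exists_continuousOn_ae_eq {I : Set ℝ} (hI : IsOpen I) (hIc : I.OrdConnected)
    {f u₀ : ℝ → ℝ} (hcont : ContinuousOn u₀ I)
    (H : ∀ a b : ℝ, a ≤ b → Icc a b ⊆ I → ∀ k, 0 ≤ k →
      (∀ x ∈ Icc a b, ∀ y ∈ Icc a b, u₀ x - u₀ y ≤ k) →
      ∀ᵐ p ∂(volume.restrict (Ioc a b)).prod (volume.restrict (Ioc a b)), f p.1 - f p.2 ≤ k) :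
    ∃ v : ℝ → ℝ, f =ᵐ[volume.restrict I] v ∧ ContinuousOn v I ∧
      ∀ k, (∀ x ∈ I, ∀ y ∈ I, u₀ x - u₀ y ≤ k) → ∀ x ∈ I, ∀ y ∈ I, v x - v y ≤ k := by
  -- a set of full measure on which `f` inherits the oscillation bounds on rational intervals
  have hrat : ∀ q : ℚ × ℚ, ∃ E : Set ℝ,
      (Icc (q.1 : ℝ) q.2 ⊆ I → ∀ᵐ x ∂(volume.restrict (Ioc (q.1 : ℝ) q.2)), x ∈ E) ∧
      ∀ k, 0 ≤ k → (∀ x ∈ Icc (q.1 : ℝ) q.2, ∀ y ∈ Icc (q.1 : ℝ) q.2, u₀ x - u₀ y ≤ k) →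
        ∀ x ∈ E, ∀ y ∈ E, f x - f y ≤ k := by
    intro q
    by_cases hq : (q.1 : ℝ) ≤ q.2 ∧ Icc (q.1 : ℝ) q.2 ⊆ I
    · have hc := hcont.mono hq.2
      have hne : (Icc (q.1 : ℝ) q.2).Nonempty := nonempty_Icc.2 hq.1
      obtain ⟨M, hM, hM'⟩ := isCompact_Icc.exists_isMaxOn hne hc
      obtain ⟨m, hm, hm'⟩ := isCompact_Icc.exists_isMinOn hne hc
      obtain ⟨E, hE, hE'⟩ := exists_ae_mem_forall_sub_le (H _ _ hq.1 hq.2 (u₀ M - u₀ m)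
        (sub_nonneg.2 (hM' hm)) fun x hx y hy => sub_le_sub (hM' hx) (hm' hy))
      exact ⟨E, fun _ => hE, fun k _ hk x hx y hy => (hE' x hx y hy).trans (hk M hM m hm)⟩
    · refine ⟨∅, fun hsub => ?_, by simp⟩
      have : Ioc (q.1 : ℝ) q.2 = ∅ := Ioc_eq_empty fun hlt => hq ⟨hlt.le, hsub⟩
      simp [this]
  choose E hE hE' using hrat
  set A : Set ℝ := {x | x ∈ I ∧
    ∀ q : ℚ × ℚ, Icc (q.1 : ℝ) q.2 ⊆ I → x ∈ Ioc (q.1 : ℝ) q.2 → x ∈ E q}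
  have hAae : ∀ᵐ x ∂(volume.restrict I), x ∈ A := by
    refine (ae_restrict_mem hI.measurableSet).and ?_
    rw [ae_all_iff]
    intro q
    by_cases hq : Icc (q.1 : ℝ) q.2 ⊆ I
    · have := hE q hq
      rw [ae_restrict_iff' measurableSet_Ioc] at this
      filter_upwards [ae_restrict_of_ae this] with x hx _ hxq using hx hxq
    · exact Filter.Eventually.of_forall fun _ h => absurd h hq
  have hAI : A ⊆ I := fun x hx => hx.1
  have hIA : I ⊆ closure A := (subset_closure_of_ae_mem hI hAae).trans
    (closure_mono inter_subset_left)
  have hfA : ∀ a b : ℚ, Icc (a : ℝ) b ⊆ I → ∀ k, 0 ≤ k →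
      (∀ x ∈ Icc (a : ℝ) b, ∀ y ∈ Icc (a : ℝ) b, u₀ x - u₀ y ≤ k) →
      ∀ x ∈ A ∩ Ioo (a : ℝ) b, ∀ y ∈ A ∩ Ioo (a : ℝ) b, f x - f y ≤ k :=
    fun a b hab k hk hk' x hx y hy => hE' (a, b) k hk hk'
      x (hx.1.2 (a, b) hab (Ioo_subset_Ioc_self hx.2)) y
      (hy.1.2 (a, b) hab (Ioo_subset_Ioc_self hy.2))
  have hlim : ∀ x ∈ I, ∃ l, Filter.Tendsto f (nhdsWithin x A) (nhds l) := by
    intro x hx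
    have := mem_closure_iff_nhdsWithin_neBot.1 (hIA hx)
    rw [← cauchy_map_iff_exists_tendsto, Metric.cauchy_iff]
    refine ⟨inferInstance, fun ε hε => ?_⟩
    obtain ⟨δ, hδ, hδ'⟩ := Metric.continuousOn_iff.1 hcont x hx (ε / 4) (by positivity)
    have hx' : x ∈ I ∩ Metric.ball x δ := ⟨hx, Metric.mem_ball_self hδ⟩
    have hIc' : (I ∩ Metric.ball x δ).OrdConnected := by
      rw [Real.ball_eq_Ioo]; exact hIc.inter ordConnected_Ioo
    obtain ⟨a, b, hab, hxab, -⟩ :=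
      exists_rat_Icc_subset (hI.inter Metric.isOpen_ball) hIc' hx' hx'
    have hosc : ∀ y ∈ Icc (a : ℝ) b, ∀ y' ∈ Icc (a : ℝ) b, u₀ y - u₀ y' ≤ ε / 2 := by
      intro y hy y' hy'
      have h1 := hδ' y (hab hy).1 (hab hy).2
      have h2 := hδ' y' (hab hy').1 (hab hy').2
      rw [Real.dist_eq, abs_lt] at h1 h2
      linarith [h1.2, h2.1]
    have key := hfA a b (hab.trans inter_subset_left) (ε / 2) (by positivity) hosc
    refine ⟨f '' (A ∩ Ioo (a : ℝ) b), Filter.image_mem_map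
      (Filter.inter_mem self_mem_nhdsWithin (nhdsWithin_le_nhds (Ioo_mem_nhds hxab.1 hxab.2))), ?_⟩
    rintro _ ⟨y, hy, rfl⟩ _ ⟨y', hy', rfl⟩
    rw [Real.dist_eq, abs_lt]
    constructor <;> linarith [key y hy y' hy', key y' hy' y hy]
  have hvA : ∀ x ∈ A, extendFrom A f x = f x := by
    intro x hx
    obtain ⟨l, hl⟩ := hlim x (hAI hx)
    have : f x = l := tendsto_nhds_unique (tendsto_pure_nhds f x)
      (hl.mono_left (pure_le_nhdsWithin hx))
    exact extendFrom_eq (subset_closure hx) (this ▸ hl)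
  have hvc : ContinuousOn (extendFrom A f) I := continuousOn_extendFrom hIA hlim
  refine ⟨extendFrom A f, ?_, hvc, fun k hk => ?_⟩
  · filter_upwards [hAae] with x hx using (hvA x hx).symm
  · refine sub_le_of_subset_closure hvc hAI hIA fun x hx y hy => ?_
    rw [hvA x hx, hvA y hy]
    obtain ⟨a, b, hab, hxab, hyab⟩ := exists_rat_Icc_subset hI hIc hx.1 hy.1
    have hk0 : 0 ≤ k := by simpa using hk x hx.1 x hx.1
    exact hfA a b hab k hk0 (fun x hx y hy => hk x (hab hx) y (hab hy)) x ⟨hx, hxab⟩ y ⟨hy, hyab⟩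

theorem bddAbove_and_bddBelow_of_forall_sub_le {I : Set ℝ} {f : ℝ → ℝ} {k : ℝ}
    (h : ∀ x ∈ I, ∀ y ∈ I, f x - f y ≤ k) : BddAbove (f '' I) ∧ BddBelow (f '' I) := by
  rcases I.eq_empty_or_nonempty with rfl | ⟨c, hc⟩
  · simp
  · constructor
    · refine ⟨f c + k, ?_⟩
      rintro _ ⟨x, hx, rfl⟩
      linarith [h x hx c hc]
    · refine ⟨f c - k, ?_⟩
      rintro _ ⟨x, hx, rfl⟩
      linarith [h c hc x hx]

theorem sub_le_osc {I : Set ℝ} {f : ℝ → ℝ} (ha : BddAbove (f '' I)) (hb : BddBelow (f '' I))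
    {x y : ℝ} (hx : x ∈ I) (hy : y ∈ I) : f x - f y ≤ osc I f :=
  sub_le_sub (le_csSup ha (mem_image_of_mem f hx)) (csInf_le hb (mem_image_of_mem f hy))

theorem osc_le_of_forall_sub_le {I : Set ℝ} (hne : I.Nonempty) {f : ℝ → ℝ} {k : ℝ}
    (h : ∀ x ∈ I, ∀ y ∈ I, f x - f y ≤ k) : osc I f ≤ k := by
  have h1 : ∀ y ∈ I, sSup (f '' I) ≤ k + f y := fun y hy => csSup_le (hne.image f) (by
    rintro _ ⟨x, hx, rfl⟩
    linarith [h x hx y hy])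
  have h2 : sSup (f '' I) - k ≤ sInf (f '' I) := le_csInf (hne.image f) (by
    rintro _ ⟨y, hy, rfl⟩
    linarith [h1 y hy])
  unfold osc
  linarith

end TVF

theorem mainTheorem4 (J : Set ℝ) (hJ : IsOpen J) (hJc : J.OrdConnected)
    (u₀ : ℝ → ℝ) (u : ℝ → ℝ → ℝ) (hu : TVF.IsStrongSolution J u₀ u)
    (I : Set ℝ) (hI : IsOpen I) (hIc : I.OrdConnected) (hIJ : I ⊆ J)
    (hcont : ContinuousOn u₀ I) (t : ℝ) (ht : 0 ≤ t) :
    (BddAbove (u₀ '' I) ∧ BddBelow (u₀ '' I)) ∧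
    ∃ v : ℝ → ℝ, u t =ᵐ[volume.restrict I] v ∧ ContinuousOn v I ∧
      BddAbove (v '' I) ∧ BddBelow (v '' I) ∧ TVF.osc I v ≤ TVF.osc I u₀ := by
  obtain ⟨z, g, D, h⟩ := hu
  obtain ⟨C, hC⟩ := h.exists_sub_le hJ hJc hI hIc hIJ hcont
  have hbdd := TVF.bddAbove_and_bddBelow_of_forall_sub_le hC
  obtain ⟨v, huv, hv, hvk⟩ := TVF.exists_continuousOn_ae_eq (f := u t) hI hIc hcont
    fun a b hab hsub k hk hk₀ =>
      h.ae_sub_le hJ hJc hab (hsub.trans hIJ) (hcont.mono hsub) hk hk₀ ht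
  have hvosc := hvk _ fun x hx y hy => TVF.sub_le_osc hbdd.1 hbdd.2 hx hy
  obtain ⟨hva, hvb⟩ := TVF.bddAbove_and_bddBelow_of_forall_sub_le hvosc
  refine ⟨hbdd, v, huv, hv, hva, hvb, ?_⟩
  rcases I.eq_empty_or_nonempty with rfl | hne
  · simp [TVF.osc]
  · exact TVF.osc_le_of_forall_sub_le hne hvosc
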